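/- Let $M$ be a smooth (Hausdorff, second countable) manifold of dimension $m+n$ without boundary, and let $\mathbf D$ be a smooth $m$-dimensional tangent distribution on $M$: to each $x\in M$ an $m$-dimensional subspace $\mathbf D_x\subseteq T_xM$ is assigned such that every point of $M$ has an open neighbourhood on which $\mathbf D$ is spanned by $m$ smooth vector fields. A ($k$-dimensional) integral manifold of $\mathbf D$ is a nonempty injectively immersed smooth $k$-dimensional submanifold $N\subseteq M$ (second countable, not necessarily connected) with $T_xN\subseteq\mathbf D_x$ for all $x\in N$. It is called maximal if every $x\in N$ has an open neighbourhood $U$ in $M$ such that no integral manifold $N'$ with $\dim N'>\dim N$ contains $N\cap U$. The distribution $\mathbf D$ is called completely integrable if $\dim N=\dim\mathbf D=m$ for every maximal integral manifold $N$ of $\mathbf D$. For a smooth vector field $X$ on $M$, let $\mathrm{Fl}^X_t$ be its maximal (possibly only partially defined) flow. $X$ is called an (infinitesimal) symmetry of $\mathbf D$ if the flow preserves $\mathbf D$, i.e. $(d\,\mathrm{Fl}^X_t)_x(\mathbf D_x)=\mathbf D_{\mathrm{Fl}^X_t(x)}$ for all $t\in\mathbb R$ and all $x\in M$ for which $\mathrm{Fl}^X_t(x)$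 is defined. Let $\mathrm{Sym}_{\mathbf D}$ be the set of all symmetries of $\mathbf D$. **Theorem.** $\mathbf D$ is completely integrable if and only if $\mathbf D\subseteq\mathrm{Sym}_{\mathbf D}$, i.e. if and only if every smooth vector field $X$ on $M$ with $X(x)\in\mathbf D_x$ for all $x\in M$ is a symmetry of $\mathbf D$. -/

import Mathlib

open Set
open scoped Manifold ContDiff

universe u

noncomputable section

/-- A smooth `m`-dimensional tangent distribution on an `(m + n)`-dimensional manifold `M`:
a choice of an `m`-dimensional subspace of each tangent space which is, near each point,
the span of `m` smooth vector fields. -/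
structure TangentDistribution (m n : ℕ) (M : Type u) [TopologicalSpace M]
    [ChartedSpace (EuclideanSpace ℝ (Fin (m + n))) M] [IsManifold (𝓡 (m + n)) ∞ M] where
  /-- the subspace `D x` of the tangent space at `x` -/
  space : (x : M) → Submodule ℝ (TangentSpace (𝓡 (m + n)) x)
  finrank_space : ∀ x : M, Module.finrank ℝ (space x) = m
  smooth : ∀ x : M, ∃ U : Set M, IsOpen U ∧ x ∈ U ∧
    ∃ X : Fin m → (y : M) → TangentSpace (𝓡 (m + n)) y,
      (∀ i, ContMDiffOn (𝓡 (m + n)) (𝓡 (m + n)).tangent ∞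
        (fun y => (⟨y, X i y⟩ : TangentBundle (𝓡 (m + n)) M)) U) ∧
      ∀ y ∈ U, space y = Submodule.span ℝ (range fun i => X i y)

section Flow

variable {d : ℕ} {M : Type u} [TopologicalSpace M] [ChartedSpace (EuclideanSpace ℝ (Fin d)) M]
  [IsManifold (𝓡 d) ∞ M]

/-- `X` is a smooth vector field on `M`. -/
def IsSmoothVectorField (X : (x : M) → TangentSpace (𝓡 d) x) : Prop :=
  ContMDiff (𝓡 d) (𝓡 d).tangent ∞ (fun x => (⟨x, X x⟩ : TangentBundle (𝓡 d) M))

/-- `γ` is, on some open interval containing `0` and `t`, an integral curve of `X` starting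
at `x`. -/
def IsIntegralCurveFromTo (X : (x : M) → TangentSpace (𝓡 d) x) (x : M) (t : ℝ) (γ : ℝ → M) :
    Prop :=
  γ 0 = x ∧ ∃ a b : ℝ, 0 ∈ Ioo a b ∧ t ∈ Ioo a b ∧ IsMIntegralCurveOn γ X (Ioo a b)

/-- The points at which the time `t` map of the (maximal, possibly not complete) flow of `X` is
defined. -/
def flowDomain (X : (x : M) → TangentSpace (𝓡 d) x) (t : ℝ) : Set M :=
  {x | ∃ γ : ℝ → M, IsIntegralCurveFromTo X x t γ}

open Classical in
/-- The time `t` map of the maximal flow of `X`: it sends `x ∈ flowDomain X t` to `γ t`, where `γ`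
is the integral curve of `X` starting at `x`. (Its value off `flowDomain X t` is irrelevant.) -/
def flowMap (X : (x : M) → TangentSpace (𝓡 d) x) (t : ℝ) (x : M) : M :=
  if h : ∃ γ : ℝ → M, IsIntegralCurveFromTo X x t γ then h.choose t else x

/-- The flow map does not depend on the choice of the integral curve. -/
theorem flowMap_eq [T2Space M] {X : (x : M) → TangentSpace (𝓡 d) x}
    (hX : IsSmoothVectorField X) {x : M} {t : ℝ} {γ : ℝ → M}
    (hγ : IsIntegralCurveFromTo X x t γ) : flowMap X t x = γ t := by
  have h : ∃ γ : ℝ → M, IsIntegralCurveFromTo X x t γ := ⟨γ, hγ⟩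
  have e : flowMap X t x = h.choose t := by
    unfold flowMap
    rw [dif_pos h]
  rw [e]
  obtain ⟨h0, a, b, h0ab, htab, hc⟩ := h.choose_spec
  obtain ⟨g0, a', b', h0ab', htab', hc'⟩ := hγ
  have hs : Ioo (max a a') (min b b') ⊆ Ioo a b := fun s hs =>
    ⟨lt_of_le_of_lt (le_max_left _ _) hs.1, lt_of_lt_of_le hs.2 (min_le_left _ _)⟩
  have hs' : Ioo (max a a') (min b b') ⊆ Ioo a' b' := fun s hs =>
    ⟨lt_of_le_of_lt (le_max_right _ _) hs.1, lt_of_lt_of_le hs.2 (min_le_right _ _)⟩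
  exact isMIntegralCurveOn_Ioo_eqOn_of_contMDiff_boundaryless (I := 𝓡 d) (t₀ := 0)
    ⟨max_lt h0ab.1 h0ab'.1, lt_min h0ab.2 h0ab'.2⟩
    (ContMDiff.of_le hX (by norm_num)) (hc.mono hs) (hc'.mono hs') (h0.trans g0.symm)
    ⟨max_lt htab.1 htab'.1, lt_min htab.2 htab'.2⟩

end Flow

namespace TangentDistribution

variable {m n : ℕ} {M : Type u} [TopologicalSpace M]
  [ChartedSpace (EuclideanSpace ℝ (Fin (m + n))) M] [IsManifold (𝓡 (m + n)) ∞ M]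

/-- The smooth vector fields on `M` which lie in the distribution `D`. -/
def vectorFields (D : TangentDistribution m n M) :
    Set ((x : M) → TangentSpace (𝓡 (m + n)) x) :=
  {X | IsSmoothVectorField X ∧ ∀ x, X x ∈ D.space x}

/-- The differential of `F`, which is defined on `U`, maps `D x` onto `D (F x)` for all `x ∈ U`. -/
def PreservedOn (D : TangentDistribution m n M) (F : M → M) (U : Set M) : Prop :=
  ∀ x ∈ U, (D.space x).map (mfderiv (𝓡 (m + n)) (𝓡 (m + n)) F x).toLinearMap = D.space (F x)

/-- The (infinitesimal) symmetries of `D`: the smooth vector fields such that every time `t` map of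
their flow preserves `D`, wherever it is defined. -/
def symmetries (D : TangentDistribution m n M) :
    Set ((x : M) → TangentSpace (𝓡 (m + n)) x) :=
  {X | IsSmoothVectorField X ∧ ∀ t : ℝ, D.PreservedOn (flowMap X t) (flowDomain X t)}

/-- A `k`-dimensional integral manifold of `D`: a (nonempty, second countable) smooth
`k`-dimensional manifold with an injective smooth immersion `f` into `M` whose tangent spaces are
contained in `D`. -/
structure IntegralManifold (D : TangentDistribution m n M) (k : ℕ) where
  /-- the abstract manifold -/
  carrier : Type u
  [top : TopologicalSpace carrier]
  [charted : ChartedSpace (EuclideanSpace ℝ (Fin k)) carrier]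
  [isManifold : IsManifold (𝓡 k) ∞ carrier]
  [secondCountable : SecondCountableTopology carrier]
  [nonempty : Nonempty carrier]
  /-- the inclusion into `M` -/
  f : carrier → M
  injective : Function.Injective f
  immersion : Manifold.IsImmersion (𝓡 k) (𝓡 (m + n)) ∞ f
  tangent : ∀ p, (mfderiv (𝓡 k) (𝓡 (m + n)) f p).range ≤ D.space (f p)

/-- The underlying subset of `M` of an integral manifold. -/
def IntegralManifold.toSet {D : TangentDistribution m n M} {k : ℕ} (N : D.IntegralManifold k) :
    Set M := range N.f

/-- `N` is a maximal integral manifold: every `x ∈ N` has an open neighbourhood `U` such that no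
integral manifold of larger dimension contains `N ∩ U`. -/
def IntegralManifold.IsMaximal {D : TangentDistribution m n M} {k : ℕ}
    (N : D.IntegralManifold k) : Prop :=
  ∀ x ∈ N.toSet, ∃ U : Set M, IsOpen U ∧ x ∈ U ∧
    ¬ ∃ (l : ℕ) (N' : D.IntegralManifold l), k < l ∧ N.toSet ∩ U ⊆ N'.toSet

/-- `D` is completely integrable: every maximal integral manifold has the dimension of `D`. -/
def IsCompletelyIntegrable (D : TangentDistribution m n M) : Prop :=
  ∀ (k : ℕ) (N : D.IntegralManifold k), N.IsMaximal → k = m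

end TangentDistribution

end

/-!
Everything is reduced to the existence of flat charts: coordinates with values in `ℝᵐ × ℝⁿ` in which
`D` is the distribution of horizontal subspaces `ℝᵐ × 0` (`IsFlatChart`, `HasFlatCharts`). Near each
point there are coordinates in which `D` is the distribution of the graphs of linear maps
`A y : ℝᵐ → ℝⁿ` depending smoothly on `y` (`exists_isGraphChart`). The fields `y ↦ (u, A y u)` with
constant `u` span `D`, and their brackets are vertical, so `D` is involutive if and only if these
brackets vanish (`IsInvolutiveAt`). In this case straightening the solutions of `y' = (w, A y w)`
gives flat charts (`exists_flat_coordinates`). This is the theorem of Frobenius; it needs the smooth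
dependence of solutions of ordinary differential equations on parameters, which is obtained from the
implicit function theorem in a space of continuous curves (`exists_smooth_solutions`).

If `D` is completely integrable, the integral manifolds of dimension `m` are dense: in any open set
there are zero-dimensional integral manifolds, and one of the largest possible dimension, cut down
to the open set, is maximal, hence has dimension `m`. Differentiating the tangency condition shows
that `D` is involutive at their points, and by continuity `D` is involutive everywhere
(`hasFlatCharts_of_isCompletelyIntegrable`). In a flat chart the flow of a vector field in `D`
preserves the second component, hence `D`, for small times; along an integral curve the local
statements combine to one for all times (`HasFlatCharts.vectorFields_subset_symmetries`).

Conversely, let the flows of all vector fields in `D` preserve `D`. Differentiating this at time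
zero for the fields `(u, A u)`, cut off to all of `M`, shows that `D` is involutive
(`IsGraphChart.isInvolutiveAt_of_vectorFields_subset`), so there are flat charts. Their horizontal
plaques are the charts of an `m`-dimensional manifold structure on the set `M`, which in general is
not second countable (`HasFlatCharts.LeafSpace`). An integral manifold `N` of any dimension is
second countable, hence covered by countably many plaques. Their union is open in the leaf space and
second countable, so it is an `m`-dimensional integral manifold containing `N`, and `N` is not
maximal unless its dimension is `m` (`HasFlatCharts.isCompletelyIntegrable`).
-/

noncomputable section

open Filter Topology

/-! ### Superposition operators on spaces of continuous curves -/

section Superposition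

variable {K : Type*} [TopologicalSpace K] [CompactSpace K] {E F : Type u}
  [NormedAddCommGroup E] [NormedSpace ℝ E] [NormedAddCommGroup F] [NormedSpace ℝ F]

/-- The pointwise bilinear map `(L, γ) ↦ (k ↦ B (L k) (γ k))` on continuous maps. -/
def pointwiseBilin (K : Type*) [TopologicalSpace K] [CompactSpace K]
    {G E F : Type*} [NormedAddCommGroup G] [NormedSpace ℝ G] [NormedAddCommGroup E]
    [NormedSpace ℝ E] [NormedAddCommGroup F] [NormedSpace ℝ F] (B : G →L[ℝ] E →L[ℝ] F) :
    C(K, G) →L[ℝ] C(K, E) →L[ℝ] C(K, F) :=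
  LinearMap.mkContinuous₂
    (LinearMap.mk₂ ℝ (fun (L : C(K, G)) (γ : C(K, E)) =>
        (⟨fun k => B (L k) (γ k), by fun_prop⟩ : C(K, F)))
      (fun _ _ _ => by ext; simp) (fun _ _ _ => by ext; simp)
      (fun _ _ _ => by ext; simp) (fun _ _ _ => by ext; simp)) ‖B‖
    (fun L γ => by
      rw [ContinuousMap.norm_le _ (by positivity)]
      intro k
      simp only [LinearMap.mk₂_apply, ContinuousMap.coe_mk]
      refine (B.le_opNorm₂ _ _).trans ?_
      gcongr
      exacts [L.norm_coe_le_norm k, γ.norm_coe_le_norm k])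

@[simp]
theorem pointwiseBilin_apply {G : Type*} [NormedAddCommGroup G] [NormedSpace ℝ G]
    (B : G →L[ℝ] E →L[ℝ] F) (L : C(K, G)) (γ : C(K, E)) (k : K) :
    pointwiseBilin K B L γ k = B (L k) (γ k) := rfl

theorem ContDiff.pointwise_bilin {G X : Type*} [NormedAddCommGroup G] [NormedSpace ℝ G]
    [NormedAddCommGroup X] [NormedSpace ℝ X] (B : G →L[ℝ] E →L[ℝ] F) {g : X → C(K, G)} {n : ℕ∞ω}
    (hg : ContDiff ℝ n g) : ContDiff ℝ n (fun x => pointwiseBilin K B (g x)) :=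
  (pointwiseBilin K B).contDiff.comp hg

/-- The superposition operator `γ ↦ f ∘ γ` on continuous maps. -/
def superposition (K : Type*) [TopologicalSpace K] {E F : Type*} [TopologicalSpace E]
    [TopologicalSpace F] (f : E → F) (hf : Continuous f) (γ : C(K, E)) : C(K, F) :=
  (⟨f, hf⟩ : C(E, F)).comp γ

@[simp]
theorem superposition_apply (K : Type*) [TopologicalSpace K] {E F : Type*} [TopologicalSpace E]
    [TopologicalSpace F] (f : E → F) (hf : Continuous f) (γ : C(K, E)) (k : K) :
    superposition K f hf γ k = f (γ k) := rfl

theorem hasFDerivAt_superposition {f : E → F} (hf : ContDiff ℝ 1 f) (γ : C(K, E)) :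
    HasFDerivAt (superposition K f hf.continuous)
      (pointwiseBilin K (.id ℝ (E →L[ℝ] F))
        (superposition K (fderiv ℝ f) (hf.continuous_fderiv (by simp)) γ)) γ := by
  rw [hasFDerivAt_iff_isLittleO_nhds_zero, Asymptotics.isLittleO_iff]
  intro c hc
  have hcont : Continuous (superposition K (fderiv ℝ f) (hf.continuous_fderiv (by simp))) :=
    ContinuousMap.continuous_postcomp _
  obtain ⟨δ, hδ, H⟩ := Metric.continuousAt_iff (f := superposition K (fderiv ℝ f)
    (hf.continuous_fderiv (by simp))).1 hcont.continuousAt c hc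
  filter_upwards [Metric.ball_mem_nhds (0 : C(K, E)) hδ] with h hh
  rw [ContinuousMap.norm_le _ (by positivity)]
  intro k
  have key : ∀ w : E, ‖w‖ ≤ ‖h‖ → ‖fderiv ℝ f (γ k + w) - fderiv ℝ f (γ k)‖ ≤ c := by
    intro w hw
    -- Perturbing the curve by a constant turns uniform closeness into closeness at one point.
    have h1 : dist (γ + ContinuousMap.const K w) γ < δ := by
      rw [dist_eq_norm, add_sub_cancel_left]
      refine lt_of_le_of_lt ?_ (mem_ball_zero_iff.1 hh)
      rw [ContinuousMap.norm_le _ (norm_nonneg _)]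
      intro k
      simpa using hw
    have h2 := (ContinuousMap.dist_apply_le_dist (f := superposition K (fderiv ℝ f)
      (hf.continuous_fderiv (by simp)) (γ + ContinuousMap.const K w))
      (g := superposition K (fderiv ℝ f) (hf.continuous_fderiv (by simp)) γ) k).trans (H h1).le
    simpa [dist_eq_norm] using h2
  have hball : ∀ z ∈ Metric.closedBall (γ k) ‖h‖, ‖fderiv ℝ f z - fderiv ℝ f (γ k)‖ ≤ c := by
    intro z hz
    have := key (z - γ k) (by simpa [dist_eq_norm] using hz)
    simpa using this
  have hmv := (convex_closedBall (γ k) ‖h‖).norm_image_sub_le_of_norm_hasFDerivWithin_le'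
    (f := f) (φ := fderiv ℝ f (γ k)) (C := c)
    (fun z _ => ((hf.differentiable (by simp)) z).hasFDerivAt.hasFDerivWithinAt) hball
    (x := γ k) (y := γ k + h k) (by simp) (by simpa using h.norm_coe_le_norm k)
  simp only [add_sub_cancel_left] at hmv
  refine le_trans (le_of_eq ?_) (hmv.trans ?_)
  · simp
  · gcongr
    exact h.norm_coe_le_norm k

/-- Finite orders of differentiability. The codomain is quantified inside the induction, since the
derivative of `f` takes values in another space. -/
theorem contDiff_superposition_nat (n : ℕ) : ∀ (F : Type u) [NormedAddCommGroup F]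
    [NormedSpace ℝ F] (f : E → F) (hf : ContDiff ℝ n f),
    ContDiff ℝ n (superposition K f hf.continuous) := by
  induction n with
  | zero =>
    intro F _ _ f hf
    exact contDiff_zero.2 (ContinuousMap.continuous_postcomp _)
  | succ n ih =>
    intro F _ _ f hf
    have h1 : ContDiff ℝ 1 f := hf.of_le (by exact_mod_cast Nat.le_add_left 1 n)
    have h2 : ContDiff ℝ n (fderiv ℝ f) := hf.fderiv_right (by norm_cast)
    have h3 := ih (E →L[ℝ] F) (fderiv ℝ f) h2
    have := contDiff_succ_iff_hasFDerivAt (𝕜 := ℝ) (n := n) (f := superposition K f hf.continuous)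
    push_cast
    rw [this]
    refine ⟨fun γ => pointwiseBilin K (.id ℝ (E →L[ℝ] F))
      (superposition K (fderiv ℝ f) h2.continuous γ), ?_, fun γ => hasFDerivAt_superposition h1 γ⟩
    exact h3.pointwise_bilin (.id ℝ (E →L[ℝ] F))

/-- Composition with a smooth function is a smooth operation on continuous curves: by
`hasFDerivAt_superposition` its derivative is composition with the derivative, so that the order of
differentiability can be raised inductively. -/
theorem contDiff_superposition {f : E → F} (hf : ContDiff ℝ ∞ f) :
    ContDiff ℝ ∞ (superposition K f hf.continuous) :=
  contDiff_infty.2 fun n => contDiff_superposition_nat n F f (hf.of_le (by exact_mod_cast le_top))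

end Superposition

/-! ### The inverse function theorem for smooth maps, and cut-offs -/

/-- A smooth map with invertible derivative at a point restricts to a diffeomorphism between open
sets, on which its derivative stays invertible. -/
theorem exists_smooth_inverse {E F : Type*} [NormedAddCommGroup E] [NormedSpace ℝ E]
    [CompleteSpace E] [NormedAddCommGroup F] [NormedSpace ℝ F] {f : E → F} {U : Set E}
    (hU : IsOpen U) (hf : ContDiffOn ℝ ∞ f U) {a : E} (ha : a ∈ U) (f' : E ≃L[ℝ] F)
    (hf' : HasFDerivAt f (f' : E →L[ℝ] F) a) :
    ∃ e : OpenPartialHomeomorph E F, a ∈ e.source ∧ e.source ⊆ U ∧ (e : E → F) = f ∧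
      ContDiffOn ℝ ∞ e.symm e.target ∧
      ∀ x ∈ e.source, ∃ g : E ≃L[ℝ] F, HasFDerivAt f (g : E →L[ℝ] F) x := by
  have hfa : ContDiffAt ℝ ∞ f a := hf.contDiffAt (hU.mem_nhds ha)
  set e₀ := hfa.toOpenPartialHomeomorph f hf' (by simp) with he₀
  have hcd : ContinuousOn (fderiv ℝ f) U := hf.continuousOn_fderiv_of_isOpen hU (by simp)
  set S : Set E := U ∩ fderiv ℝ f ⁻¹' range ((↑) : (E ≃L[ℝ] F) → E →L[ℝ] F) with hS
  have hSo : IsOpen S := hcd.isOpen_inter_preimage hU ContinuousLinearEquiv.isOpen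
  have haS : a ∈ S := ⟨ha, f', hf'.fderiv.symm⟩
  have key : ∀ x ∈ S, ∃ g : E ≃L[ℝ] F, HasFDerivAt f (g : E →L[ℝ] F) x := by
    rintro x ⟨hxU, g, hg⟩
    refine ⟨g, ?_⟩
    rw [hg]
    exact ((hf.contDiffAt (hU.mem_nhds hxU)).differentiableAt (by simp)).hasFDerivAt
  refine ⟨e₀.restrOpen S hSo, ⟨hfa.mem_toOpenPartialHomeomorph_source hf' (by simp), haS⟩,
    fun x hx => hx.2.1, rfl, ?_, fun x hx => key x hx.2⟩
  intro y hy
  have hy' : (e₀.restrOpen S hSo).symm y ∈ (e₀.restrOpen S hSo).source :=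
    (e₀.restrOpen S hSo).map_target hy
  obtain ⟨g, hg⟩ := key _ hy'.2
  exact ((e₀.restrOpen S hSo).contDiffAt_symm hy hg
    (hf.contDiffAt (hU.mem_nhds hy'.2.1))).contDiffWithinAt

/-- A smooth map defined on an open set agrees near any given point with a globally smooth map. -/
theorem exists_contDiff_eventuallyEq {E G : Type*} [NormedAddCommGroup E] [NormedSpace ℝ E]
    [FiniteDimensional ℝ E] [NormedAddCommGroup G] [NormedSpace ℝ G] {f : E → G} {U : Set E}
    (hU : IsOpen U) (hf : ContDiffOn ℝ ∞ f U) {a : E} (ha : a ∈ U) :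
    ∃ g : E → G, ContDiff ℝ ∞ g ∧ g =ᶠ[𝓝 a] f := by
  obtain ⟨r, hr, hrU⟩ := Metric.isOpen_iff.1 hU a ha
  let χ : ContDiffBump a := ⟨r / 3, r / 2, by positivity, by linarith⟩
  refine ⟨fun x => χ x • f x, contDiff_iff_contDiffAt.2 fun x => ?_, ?_⟩
  · by_cases hx : x ∈ U
    · exact χ.contDiffAt.smul (hf.contDiffAt (hU.mem_nhds hx))
    · have hx' : x ∉ tsupport χ := by
        rw [χ.tsupport_eq]
        intro h
        refine hx (hrU (Metric.closedBall_subset_ball ?_ h))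
        change r / 2 < r
        linarith
      refine (contDiffAt_const (c := (0 : G))).congr_of_eventuallyEq ?_
      filter_upwards [(isClosed_tsupport χ).isOpen_compl.mem_nhds hx'] with y hy
      rw [image_eq_zero_of_notMem_tsupport hy, zero_smul]
  · filter_upwards [χ.eventuallyEq_one] with x hx
    rw [hx]
    exact one_smul _ _

/-! ### Smooth dependence of solutions of differential equations on parameters -/

section Curves

variable {V : Type u} [NormedAddCommGroup V]

/-- The extension of a curve on `[-1, 1]` to `ℝ` by constants. -/
def curveExt (γ : C(Icc (-1 : ℝ) 1, V)) (s : ℝ) : V :=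
  γ (projIcc (-1) 1 (by norm_num) s)

theorem continuous_curveExt (γ : C(Icc (-1 : ℝ) 1, V)) : Continuous (curveExt γ) :=
  γ.continuous.comp continuous_projIcc

theorem curveExt_coe (γ : C(Icc (-1 : ℝ) 1, V)) (s : Icc (-1 : ℝ) 1) : curveExt γ s = γ s := by
  simp [curveExt]

theorem norm_curveExt_le (γ : C(Icc (-1 : ℝ) 1, V)) (s : ℝ) : ‖curveExt γ s‖ ≤ ‖γ‖ :=
  γ.norm_coe_le_norm _

variable [NormedSpace ℝ V]

/-- The primitive `s ↦ ∫ σ in 0..s, γ σ` as an operator on curves. -/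
def primitiveCLM (V : Type u) [NormedAddCommGroup V] [NormedSpace ℝ V] :
    C(Icc (-1 : ℝ) 1, V) →L[ℝ] C(Icc (-1 : ℝ) 1, V) :=
  LinearMap.mkContinuous
    { toFun := fun γ => ⟨fun s => ∫ σ in (0 : ℝ)..s, curveExt γ σ, by
        refine Continuous.comp (g := fun s : ℝ => ∫ σ in (0 : ℝ)..s, curveExt γ σ)
          (intervalIntegral.continuous_primitive
            (fun a b => (continuous_curveExt γ).intervalIntegrable a b) 0) continuous_subtype_val⟩
      map_add' := fun γ η => by
        ext s
        exact intervalIntegral.integral_add ((continuous_curveExt γ).intervalIntegrable _ _)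
          ((continuous_curveExt η).intervalIntegrable _ _)
      map_smul' := fun c γ => by
        ext s
        exact intervalIntegral.integral_smul c _ } 1
    (fun γ => by
      rw [ContinuousMap.norm_le _ (by positivity)]
      intro s
      refine (intervalIntegral.norm_integral_le_of_norm_le_const
        (fun σ _ => norm_curveExt_le γ σ)).trans ?_
      rw [one_mul, sub_zero]
      exact mul_le_of_le_one_right (norm_nonneg _) (abs_le.2 s.2))

theorem primitiveCLM_apply (γ : C(Icc (-1 : ℝ) 1, V)) (s : Icc (-1 : ℝ) 1) :
    primitiveCLM V γ s = ∫ σ in (0 : ℝ)..s, curveExt γ σ := rfl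

theorem curveExt_zero_of_eq_const_add_primitive {γ g : C(Icc (-1 : ℝ) 1, V)} {x : V}
    (h : γ = ContinuousMap.const _ x + primitiveCLM V g) : curveExt γ 0 = x := by
  have := curveExt_coe γ ⟨0, by norm_num⟩
  rw [h, ContinuousMap.add_apply, primitiveCLM_apply] at this
  rw [h]
  simpa using this

theorem hasDerivAt_curveExt_of_eq_const_add_primitive [CompleteSpace V]
    {γ g : C(Icc (-1 : ℝ) 1, V)} {x : V}
    (h : γ = ContinuousMap.const _ x + primitiveCLM V g) {s : ℝ} (hs : s ∈ Ioo (-1 : ℝ) 1) :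
    HasDerivAt (curveExt γ) (curveExt g s) s := by
  have h1 : HasDerivAt (fun s => x + ∫ σ in (0 : ℝ)..s, curveExt g σ) (curveExt g s) s :=
    (intervalIntegral.integral_hasDerivAt_right ((continuous_curveExt g).intervalIntegrable _ _)
      ((continuous_curveExt g).stronglyMeasurableAtFilter _ _)
      (continuous_curveExt g).continuousAt).const_add x
  refine h1.congr_of_eventuallyEq ?_
  filter_upwards [isOpen_Ioo.mem_nhds hs] with σ hσ
  have h2 := curveExt_coe γ ⟨σ, Ioo_subset_Icc_self hσ⟩
  have h3 : γ ⟨σ, Ioo_subset_Icc_self hσ⟩ = x + ∫ τ in (0 : ℝ)..σ, curveExt g τ := by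
    conv_lhs => rw [h]
    rfl
  exact h2.trans h3

/-- A constant parameter and a curve, paired to a curve in the product space. -/
def pairCLM (P V : Type u) [NormedAddCommGroup P] [NormedSpace ℝ P]
    [NormedAddCommGroup V] [NormedSpace ℝ V] :
    P × C(Icc (-1 : ℝ) 1, V) →L[ℝ] C(Icc (-1 : ℝ) 1, P × V) :=
  ((ContinuousLinearMap.inl ℝ P V).compLeftContinuous ℝ (Icc (-1 : ℝ) 1) ∘L
      ContinuousLinearMap.const ℝ (Icc (-1 : ℝ) 1)) ∘L ContinuousLinearMap.fst ℝ P _ +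
    (ContinuousLinearMap.inr ℝ P V).compLeftContinuous ℝ (Icc (-1 : ℝ) 1) ∘L
      ContinuousLinearMap.snd ℝ P _

theorem pairCLM_apply {P V : Type u} [NormedAddCommGroup P] [NormedSpace ℝ P]
    [NormedAddCommGroup V] [NormedSpace ℝ V] (z : P × C(Icc (-1 : ℝ) 1, V)) (s : Icc (-1 : ℝ) 1) :
    pairCLM P V z s = (z.1, z.2 s) := by
  simp [pairCLM]

variable {P : Type u} [NormedAddCommGroup P] [NormedSpace ℝ P]

/-- The operator `(p, γ) ↦ ∫ Y (p, γ)`, whose fixed points up to constants are the solutions of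
`γ' = Y (p, γ)`. -/
def picardOperator (Y : P × V → V) (hY : Continuous Y) (z : P × C(Icc (-1 : ℝ) 1, V)) :
    C(Icc (-1 : ℝ) 1, V) :=
  primitiveCLM V (superposition _ Y hY (pairCLM P V z))

theorem contDiff_picardOperator {Y : P × V → V} (hY : ContDiff ℝ ∞ Y) :
    ContDiff ℝ ∞ (picardOperator Y hY.continuous) :=
  (primitiveCLM V).contDiff.comp ((contDiff_superposition hY).comp (pairCLM P V).contDiff)

theorem hasFDerivAt_picardOperator {Y : P × V → V} (hY : ContDiff ℝ ∞ Y)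
    (z : P × C(Icc (-1 : ℝ) 1, V)) :
    HasFDerivAt (picardOperator Y hY.continuous)
      (primitiveCLM V ∘L pointwiseBilin _ (.id ℝ (P × V →L[ℝ] V))
        (superposition _ (fderiv ℝ Y) (hY.continuous_fderiv (by simp)) (pairCLM P V z)) ∘L
          pairCLM P V) z :=
  (primitiveCLM V).hasFDerivAt.comp z
    ((hasFDerivAt_superposition (hY.of_le (by simp)) _).comp z (pairCLM P V).hasFDerivAt)

/-- The first variation of a smooth family of solutions solves the linearised equation. -/
theorem fderiv_solutions {Y : P × V → V} (hY : ContDiff ℝ ∞ Y) {W : Set (P × V)} (hW : IsOpen W)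
    {Γ : P × V → C(Icc (-1 : ℝ) 1, V)} (hΓ : ContDiffOn ℝ ∞ Γ W)
    (h : ∀ q ∈ W, Γ q = ContinuousMap.const _ q.2 + picardOperator Y hY.continuous (q.1, Γ q))
    {q : P × V} (hq : q ∈ W) (dq : P × V) :
    fderiv ℝ Γ q dq = ContinuousMap.const _ dq.2 + primitiveCLM V
      (pointwiseBilin _ (.id ℝ (P × V →L[ℝ] V))
        (superposition _ (fderiv ℝ Y) (hY.continuous_fderiv (by simp)) (pairCLM P V (q.1, Γ q)))
        (pairCLM P V (dq.1, fderiv ℝ Γ q dq))) := by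
  have hd : HasFDerivAt Γ (fderiv ℝ Γ q) q :=
    ((hΓ.contDiffAt (hW.mem_nhds hq)).differentiableAt (by simp)).hasFDerivAt
  have h2 : HasFDerivAt (fun q : P × V => (q.1, Γ q))
      ((ContinuousLinearMap.fst ℝ P V).prod (fderiv ℝ Γ q)) q := hasFDerivAt_fst.prodMk hd
  have h3 := HasFDerivAt.comp q (g := picardOperator Y hY.continuous)
    (hasFDerivAt_picardOperator hY (q.1, Γ q)) h2
  have h4 : HasFDerivAt (fun q : P × V => ContinuousLinearMap.const ℝ (Icc (-1 : ℝ) 1) q.2)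
      (ContinuousLinearMap.const ℝ (Icc (-1 : ℝ) 1) ∘L ContinuousLinearMap.snd ℝ P V) q :=
    (ContinuousLinearMap.const ℝ (Icc (-1 : ℝ) 1) ∘L
      ContinuousLinearMap.snd ℝ P V).hasFDerivAt
  have h5 := (h4.add h3).congr_of_eventuallyEq (f₁ := Γ) (by
    filter_upwards [hW.mem_nhds hq] with q' hq'
    exact h q' hq')
  have h6 := congrArg (fun L : P × V →L[ℝ] C(Icc (-1 : ℝ) 1, V) => L dq) (hd.unique h5)
  exact h6

variable [CompleteSpace V] [CompleteSpace P]

/-- **Smooth dependence on parameters and initial values.** If `Y (p₀, ·) = 0`, then for `p` close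
to `p₀` the equation `γ' = Y (p, γ)` has solutions on the whole of `[-1, 1]`, which form a smooth
family. They come from the implicit function theorem in the Banach space of curves: at `p₀` the
derivative in `γ` of `γ - γ(0) - ∫ Y (p, γ)` is the identity. -/
theorem exists_smooth_solutions {Y : P × V → V} (hY : ContDiff ℝ ∞ Y) {p₀ : P}
    (hY0 : ∀ y, Y (p₀, y) = 0) (x₀ : V) :
    ∃ (W : Set (P × V)) (Γ : P × V → C(Icc (-1 : ℝ) 1, V)), IsOpen W ∧ (p₀, x₀) ∈ W ∧
      ContDiffOn ℝ ∞ Γ W ∧ Γ (p₀, x₀) = ContinuousMap.const _ x₀ ∧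
      ∀ q ∈ W, Γ q = ContinuousMap.const _ q.2 + picardOperator Y hY.continuous (q.1, Γ q) := by
  let G : (P × V) × C(Icc (-1 : ℝ) 1, V) → (P × V) × C(Icc (-1 : ℝ) 1, V) := fun z =>
    (z.1, z.2 - ContinuousLinearMap.const ℝ (Icc (-1 : ℝ) 1) z.1.2 -
      picardOperator Y hY.continuous (z.1.1, z.2))
  have hG : ContDiff ℝ ∞ G := by
    refine contDiff_fst.prodMk (ContDiff.sub (contDiff_snd.sub ?_) ?_)
    · exact (ContinuousLinearMap.contDiff (E := V) (F := C(Icc (-1 : ℝ) 1, V))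
        (ContinuousLinearMap.const ℝ (Icc (-1 : ℝ) 1))).comp (contDiff_snd.comp contDiff_fst)
    · exact (contDiff_picardOperator hY).comp ((contDiff_fst.comp contDiff_fst).prodMk contDiff_snd)
  set γ₀ : C(Icc (-1 : ℝ) 1, V) := ContinuousMap.const _ x₀
  have hpair : pairCLM P V (p₀, γ₀) = ContinuousMap.const _ (p₀, x₀) := by
    ext s
    · simp [pairCLM_apply]
    · simp [pairCLM_apply, γ₀]
  -- At `p₀` the field vanishes, so its derivative only sees the parameter, and the derivative of
  -- `G` is the identity plus the strictly triangular term `T`.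
  let D₀ : P × V →L[ℝ] V := fderiv ℝ Y (p₀, x₀)
  have hD₀ : ∀ v, D₀ (0, v) = 0 := by
    intro v
    have h1 : HasFDerivAt (fun y => Y (p₀, y)) (D₀ ∘L ContinuousLinearMap.inr ℝ P V) x₀ :=
      HasFDerivAt.comp x₀ ((hY.differentiable (by simp)) (p₀, x₀)).hasFDerivAt
        (hasFDerivAt_prodMk_right p₀ x₀)
    have h2 : HasFDerivAt (fun y => Y (p₀, y)) (0 : V →L[ℝ] V) x₀ := by
      simp only [hY0]
      exact hasFDerivAt_const _ _
    have h3 := h1.unique h2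
    simpa using congrArg (fun L : V →L[ℝ] V => L v) h3
  let T : P × V →L[ℝ] C(Icc (-1 : ℝ) 1, V) :=
    -(ContinuousLinearMap.const ℝ (Icc (-1 : ℝ) 1) ∘L ContinuousLinearMap.snd ℝ P V) -
      primitiveCLM V ∘L ContinuousLinearMap.const ℝ (Icc (-1 : ℝ) 1) ∘L D₀ ∘L
        ContinuousLinearMap.inl ℝ P V ∘L ContinuousLinearMap.fst ℝ P V
  let L := ContinuousLinearEquiv.skewProd (ContinuousLinearEquiv.refl ℝ (P × V))
    (ContinuousLinearEquiv.refl ℝ C(Icc (-1 : ℝ) 1, V)) T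
  have hL : HasFDerivAt G (L : (P × V) × C(Icc (-1 : ℝ) 1, V) →L[ℝ] _) ((p₀, x₀), γ₀) := by
    have h1 := hasFDerivAt_picardOperator hY (p₀, γ₀)
    have h2 : HasFDerivAt (fun z : (P × V) × C(Icc (-1 : ℝ) 1, V) => (z.1.1, z.2))
        (((ContinuousLinearMap.fst ℝ P V) ∘L ContinuousLinearMap.fst ℝ (P × V) _).prod
          (ContinuousLinearMap.snd ℝ (P × V) _)) ((p₀, x₀), γ₀) :=
      ContinuousLinearMap.hasFDerivAt (((ContinuousLinearMap.fst ℝ P V) ∘L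
        ContinuousLinearMap.fst ℝ (P × V) C(Icc (-1 : ℝ) 1, V)).prod
          (ContinuousLinearMap.snd ℝ (P × V) C(Icc (-1 : ℝ) 1, V)))
    have h3 := HasFDerivAt.comp ((p₀, x₀), γ₀) (g := picardOperator Y hY.continuous) h1 h2
    have h4 : HasFDerivAt (fun z : (P × V) × C(Icc (-1 : ℝ) 1, V) =>
        z.2 - ContinuousLinearMap.const ℝ (Icc (-1 : ℝ) 1) z.1.2)
        (ContinuousLinearMap.snd ℝ (P × V) _ - ContinuousLinearMap.const ℝ (Icc (-1 : ℝ) 1) ∘L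
          (ContinuousLinearMap.snd ℝ P V) ∘L ContinuousLinearMap.fst ℝ (P × V) _)
        ((p₀, x₀), γ₀) :=
      ContinuousLinearMap.hasFDerivAt (ContinuousLinearMap.snd ℝ (P × V) C(Icc (-1 : ℝ) 1, V) -
        ContinuousLinearMap.const ℝ (Icc (-1 : ℝ) 1) ∘L
          (ContinuousLinearMap.snd ℝ P V) ∘L ContinuousLinearMap.fst ℝ (P × V) _)
    refine (hasFDerivAt_fst.prodMk (h4.sub h3)).congr_fderiv ?_
    refine ContinuousLinearMap.ext fun z => Prod.ext rfl ?_
    have h5 : pointwiseBilin _ (.id ℝ (P × V →L[ℝ] V))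
        (superposition _ (fderiv ℝ Y) (hY.continuous_fderiv (by simp)) (pairCLM P V (p₀, γ₀)))
          (pairCLM P V (z.1.1, z.2)) = ContinuousLinearMap.const ℝ (Icc (-1 : ℝ) 1)
            (D₀ (z.1.1, 0)) := by
      ext s
      rw [pointwiseBilin_apply, hpair]
      have : ((z.1.1, z.2 s) : P × V) = (z.1.1, 0) + (0, z.2 s) := by simp
      simp only [superposition_apply, ContinuousMap.const_apply, pairCLM_apply,
        ContinuousLinearMap.id_apply, ContinuousLinearMap.const_apply_apply]
      rw [this, map_add]
      change D₀ _ + D₀ _ = _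
      rw [hD₀, add_zero]
    change z.2 - ContinuousLinearMap.const ℝ (Icc (-1 : ℝ) 1) z.1.2 - primitiveCLM V
      (pointwiseBilin _ (.id ℝ (P × V →L[ℝ] V))
        (superposition _ (fderiv ℝ Y) (hY.continuous_fderiv (by simp)) (pairCLM P V (p₀, γ₀)))
          (pairCLM P V (z.1.1, z.2))) = z.2 + T z.1
    rw [h5]
    simp only [T, sub_apply, neg_apply,
      ContinuousLinearMap.comp_apply, ContinuousLinearMap.coe_snd', ContinuousLinearMap.coe_fst',
      ContinuousLinearMap.inl_apply]
    abel
  obtain ⟨e, hae, -, hee, hes, -⟩ := exists_smooth_inverse isOpen_univ hG.contDiffOn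
    (mem_univ ((p₀, x₀), γ₀)) L hL
  have hG0 : G ((p₀, x₀), γ₀) = ((p₀, x₀), 0) := by
    refine Prod.ext rfl ?_
    have : picardOperator Y hY.continuous (p₀, γ₀) = 0 := by
      rw [picardOperator, hpair]
      have : superposition (Icc (-1 : ℝ) 1) Y hY.continuous
          (ContinuousMap.const _ (p₀, x₀)) = 0 := by
        ext s
        simp [hY0]
      rw [this, map_zero]
    change γ₀ - γ₀ - picardOperator Y hY.continuous (p₀, γ₀) = 0
    rw [this]
    simp
  have hi : Continuous fun q : P × V => (q, (0 : C(Icc (-1 : ℝ) 1, V))) := by fun_prop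
  refine ⟨(fun q => (q, 0)) ⁻¹' e.target, fun q => (e.symm (q, 0)).2, e.open_target.preimage hi,
    ?_, ?_, ?_, ?_⟩
  · rw [mem_preimage, ← hG0, ← hee]
    exact e.map_source hae
  · exact contDiff_snd.comp_contDiffOn (hes.comp (contDiff_id.prodMk contDiff_const).contDiffOn
      fun q hq => hq)
  · change (e.symm ((p₀, x₀), 0)).2 = γ₀
    rw [← hG0, ← hee, e.left_inv hae]
  · intro q hq
    have h1 : G (e.symm (q, 0)) = (q, 0) := by
      rw [← hee]
      exact e.right_inv hq
    have h2 : (e.symm (q, 0)).1 = q := congrArg Prod.fst h1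
    have h3 : (e.symm (q, 0)).2 - ContinuousLinearMap.const ℝ (Icc (-1 : ℝ) 1)
        (e.symm (q, 0)).1.2 - picardOperator Y hY.continuous
          ((e.symm (q, 0)).1.1, (e.symm (q, 0)).2) = 0 := congrArg Prod.snd h1
    rw [h2, sub_sub, sub_eq_zero] at h3
    exact h3

/-- The differential equations satisfied by a smooth family of solutions and by its first
variation, in terms of derivatives. -/
theorem exists_smooth_solutions_hasDerivAt {Y : P × V → V} (hY : ContDiff ℝ ∞ Y) {p₀ : P}
    (hY0 : ∀ y, Y (p₀, y) = 0) (x₀ : V) :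
    ∃ (W : Set (P × V)) (Γ : P × V → C(Icc (-1 : ℝ) 1, V)), IsOpen W ∧ (p₀, x₀) ∈ W ∧
      ContDiffOn ℝ ∞ Γ W ∧ Γ (p₀, x₀) = ContinuousMap.const _ x₀ ∧
      ∀ q ∈ W, curveExt (Γ q) 0 = q.2 ∧
        (∀ s ∈ Ioo (-1 : ℝ) 1,
          HasDerivAt (curveExt (Γ q)) (Y (q.1, curveExt (Γ q) s)) s) ∧
        ∀ dq : P × V, curveExt (fderiv ℝ Γ q dq) 0 = dq.2 ∧
          ∀ s ∈ Ioo (-1 : ℝ) 1, HasDerivAt (curveExt (fderiv ℝ Γ q dq))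
            (fderiv ℝ Y (q.1, curveExt (Γ q) s) (dq.1, curveExt (fderiv ℝ Γ q dq) s)) s := by
  obtain ⟨W, Γ, hW, h0, hΓ, hΓ0, h⟩ := exists_smooth_solutions hY hY0 x₀
  refine ⟨W, Γ, hW, h0, hΓ, hΓ0, fun q hq => ⟨?_, fun s hs => ?_, fun dq => ⟨?_, fun s hs => ?_⟩⟩⟩
  · exact curveExt_zero_of_eq_const_add_primitive (h q hq)
  · have := hasDerivAt_curveExt_of_eq_const_add_primitive (h q hq) hs
    simpa [curveExt, pairCLM_apply] using this
  · exact curveExt_zero_of_eq_const_add_primitive (fderiv_solutions hY hW hΓ h hq dq)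
  · have := hasDerivAt_curveExt_of_eq_const_add_primitive (fderiv_solutions hY hW hΓ h hq dq) hs
    simpa [curveExt, pairCLM_apply] using this

end Curves

/-! ### The local flow of a smooth vector field on a vector space -/

/-- A smooth vector field `X` on an open subset of a vector space has a local flow `Φ`, which is
smooth in the initial value and whose derivative solves the linearised equation. It is obtained from
`exists_smooth_solutions_hasDerivAt` for the parametrised field `(a, y) ↦ a • X y` by rescaling
time. -/
theorem exists_smooth_local_flow {V : Type} [NormedAddCommGroup V] [NormedSpace ℝ V]
    [FiniteDimensional ℝ V] {X : V → V} {Ω : Set V} (hΩ : IsOpen Ω) (hX : ContDiffOn ℝ ∞ X Ω)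
    {y₀ : V} (hy₀ : y₀ ∈ Ω) :
    ∃ (ε : ℝ) (B : Set V) (Φ : ℝ → V → V), 0 < ε ∧ IsOpen B ∧ y₀ ∈ B ∧
      (∀ y ∈ B, Φ 0 y = y) ∧ (∀ t ∈ Ioo (-ε) ε, ContDiffOn ℝ ∞ (Φ t) B) ∧
      ∀ y ∈ B, ∀ t ∈ Ioo (-ε) ε, Φ t y ∈ Ω ∧ HasDerivAt (fun t => Φ t y) (X (Φ t y)) t ∧
        ∀ v : V, HasDerivAt (fun t => fderiv ℝ (Φ t) y v)
          (fderiv ℝ X (Φ t y) (fderiv ℝ (Φ t) y v)) t := by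
  have : CompleteSpace V := FiniteDimensional.complete ℝ V
  obtain ⟨g, hg, hgX⟩ := exists_contDiff_eventuallyEq hΩ hX hy₀
  obtain ⟨r, hr, hrB⟩ := Metric.mem_nhds_iff.1 (inter_mem (hΩ.mem_nhds hy₀) hgX)
  -- A solution of `γ' = a • X γ` on `[-1, 1]` becomes one of `γ' = X γ` on `[-a, a]`; below `a` is
  -- `δ / 2`.
  let Y : ℝ × V → V := fun z => z.1 • g z.2
  have hY : ContDiff ℝ ∞ Y := contDiff_fst.smul (hg.comp contDiff_snd)
  have hYd : ∀ (a : ℝ) (y v : V), fderiv ℝ Y (a, y) (0, v) = a • fderiv ℝ g y v := by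
    intro a y v
    have h1 : HasFDerivAt (fun z => Y (a, z))
        (fderiv ℝ Y (a, y) ∘L ContinuousLinearMap.inr ℝ ℝ V) y :=
      HasFDerivAt.comp y ((hY.differentiable (by simp)) (a, y)).hasFDerivAt
        (hasFDerivAt_prodMk_right a y)
    have h2 : HasFDerivAt (fun z => Y (a, z)) (a • fderiv ℝ g y) y :=
      ((hg.differentiable (by simp)) y).hasFDerivAt.const_smul a
    simpa using congrArg (fun L : V →L[ℝ] V => L v) (h1.unique h2)
  obtain ⟨W, Γ, hW, h0, hΓ, hΓ0, H⟩ := exists_smooth_solutions_hasDerivAt hY (p₀ := 0)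
    (fun y => by simp [Y]) y₀
  have hcont : ContinuousAt Γ (0, y₀) := (hΓ.contDiffAt (hW.mem_nhds h0)).continuousAt
  have hnear : W ∩ Γ ⁻¹' Metric.ball (ContinuousMap.const _ y₀) r ∈ 𝓝 ((0 : ℝ), y₀) := by
    refine inter_mem (hW.mem_nhds h0) (hcont.preimage_mem_nhds ?_)
    rw [hΓ0]
    exact Metric.ball_mem_nhds _ hr
  obtain ⟨δ, hδ, hδW⟩ := Metric.mem_nhds_iff.1 hnear
  have hmem : ∀ y ∈ Metric.ball y₀ δ,
      (δ / 2, y) ∈ W ∩ Γ ⁻¹' Metric.ball (ContinuousMap.const _ y₀) r := by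
    intro y hy
    apply hδW
    rw [Metric.mem_ball, Prod.dist_eq, max_lt_iff]
    refine ⟨?_, hy⟩
    rw [Real.dist_eq, sub_zero, abs_of_pos (by positivity)]
    linarith
  have hball : ∀ y ∈ Metric.ball y₀ δ, ∀ s, curveExt (Γ (δ / 2, y)) s ∈ Metric.ball y₀ r := by
    intro y hy s
    have h1 := (hmem y hy).2
    exact lt_of_le_of_lt (ContinuousMap.dist_apply_le_dist (f := Γ (δ / 2, y))
      (g := ContinuousMap.const _ y₀) (projIcc (-1) 1 (by norm_num) s)) h1
  have htime : ∀ t ∈ Ioo (-(δ / 2)) (δ / 2), t / (δ / 2) ∈ Ioo (-1 : ℝ) 1 := by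
    intro t ht
    have h2 : (0 : ℝ) < δ / 2 := by positivity
    constructor
    · rw [lt_div_iff₀ h2]
      linarith [ht.1]
    · rw [div_lt_iff₀ h2]
      linarith [ht.2]
  have hfd : ∀ y ∈ Metric.ball y₀ δ, ∀ t v, fderiv ℝ
      (fun y => curveExt (Γ (δ / 2, y)) (t / (δ / 2))) y v =
        curveExt (fderiv ℝ Γ (δ / 2, y) (0, v)) (t / (δ / 2)) := by
    intro y hy t v
    have h1 : HasFDerivAt Γ (fderiv ℝ Γ (δ / 2, y)) (δ / 2, y) :=
      ((hΓ.contDiffAt (hW.mem_nhds (hmem y hy).1)).differentiableAt (by simp)).hasFDerivAt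
    have h2 := HasFDerivAt.comp y h1 (hasFDerivAt_prodMk_right (δ / 2) y)
    have h3 := HasFDerivAt.comp y (ContinuousLinearMap.hasFDerivAt (𝕜 := ℝ)
      (E := C(Icc (-1 : ℝ) 1, V)) (F := V)
      (ContinuousMap.evalCLM ℝ (projIcc (-1 : ℝ) 1 (by norm_num) (t / (δ / 2))))) h2
    have h4 := h3.fderiv
    exact congrArg (fun L : V →L[ℝ] V => L v) h4
  have hresc : ∀ t : ℝ, HasDerivAt (fun t => t / (δ / 2)) (δ / 2)⁻¹ t := fun t => by
    simpa using (hasDerivAt_id t).div_const (δ / 2)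
  refine ⟨δ / 2, Metric.ball y₀ δ, fun t y => curveExt (Γ (δ / 2, y)) (t / (δ / 2)), by positivity,
    Metric.isOpen_ball, Metric.mem_ball_self hδ, fun y hy => ?_, fun t ht => ?_,
    fun y hy t ht => ⟨(hrB (hball y hy _)).1, ?_, fun v => ?_⟩⟩
  · simpa using (H _ (hmem y hy).1).1
  · exact (ContinuousLinearMap.contDiff (𝕜 := ℝ) (E := C(Icc (-1 : ℝ) 1, V)) (F := V)
      (ContinuousMap.evalCLM ℝ (projIcc (-1 : ℝ) 1 (by norm_num) (t / (δ / 2))))).comp_contDiffOn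
      (hΓ.comp (contDiff_const.prodMk contDiff_id).contDiffOn fun y hy => (hmem y hy).1)
  · have h1 := ((H _ (hmem y hy).1).2.1 _ (htime t ht)).scomp t (hresc t)
    have h2 : g (curveExt (Γ (δ / 2, y)) (t / (δ / 2))) =
        X (curveExt (Γ (δ / 2, y)) (t / (δ / 2))) :=
      (hrB (hball y hy _)).2
    simp only [Y, smul_smul] at h1
    rw [inv_mul_cancel₀ (by positivity), one_smul, h2] at h1
    exact h1
  · have h1 := (((H _ (hmem y hy).1).2.2 (0, v)).2 _ (htime t ht)).scomp t (hresc t)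
    have h2 : fderiv ℝ g (curveExt (Γ (δ / 2, y)) (t / (δ / 2))) =
        fderiv ℝ X (curveExt (Γ (δ / 2, y)) (t / (δ / 2))) := by
      apply Filter.EventuallyEq.fderiv_eq
      filter_upwards [Metric.isOpen_ball.mem_nhds (hball y hy (t / (δ / 2)))] with z hz
      exact (hrB hz).2
    rw [hYd, smul_smul, inv_mul_cancel₀ (by positivity), one_smul, h2] at h1
    simp only [hfd y hy]
    exact h1

/-! ### Involutive graph distributions are flat -/

section Flat

variable {E F : Type} [NormedAddCommGroup E] [NormedSpace ℝ E] [NormedAddCommGroup F]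
  [NormedSpace ℝ F]

/-- The distribution on `E × F` whose fibre at `y` is the graph of `A y : E → F` is involutive at
`y`: the bracket of the two vector fields `y ↦ (u, A y u)` and `y ↦ (v, A y v)`, which is
vertical, vanishes. -/
def IsInvolutiveAt (A : E × F → E →L[ℝ] F) (y : E × F) : Prop :=
  ∀ u v : E, fderiv ℝ A y (u, A y u) v = fderiv ℝ A y (v, A y v) u

/-- The derivative of the vector fields `y ↦ (w, g y w)`, which span the distribution of graphs of
`g`, jointly in the parameter `w` and the point `y`. -/
theorem fderiv_graphField {g : E × F → E →L[ℝ] F} (hg : ContDiff ℝ ∞ g) (w dw : E)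
    (y v : E × F) : fderiv ℝ (fun z : E × (E × F) => (z.1, g z.2 z.1)) (w, y) (dw, v) =
      (dw, fderiv ℝ g y v w + g y dw) := by
  have h1 : HasFDerivAt (fun z : E × (E × F) => g z.2)
      (fderiv ℝ g y ∘L ContinuousLinearMap.snd ℝ E (E × F)) (w, y) :=
    HasFDerivAt.comp (w, y) (g := g) ((hg.differentiable (by simp)) y).hasFDerivAt hasFDerivAt_snd
  have h2 := (hasFDerivAt_fst (𝕜 := ℝ) (p := (w, y))).prodMk
    (h1.clm_apply (hasFDerivAt_fst (𝕜 := ℝ) (p := (w, y))))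
  rw [h2.fderiv]
  simp [add_comm]

variable [FiniteDimensional ℝ E] [FiniteDimensional ℝ F]

/-- **Frobenius' theorem** in graph form. If the distribution of graphs of `A` is involutive on an
open set, then near each point there are coordinates which turn it into the distribution of
horizontal subspaces `E × 0`. The inverse coordinates send `(w, z)` to the time-one value of the
solution of `y' = (w, A y w)` starting at `(y₀.1, z)`. The deviation of its derivative in the
directions of `w` from the graph of `A` solves a homogeneous linear equation, thanks to
involutivity, hence vanishes. -/
theorem exists_flat_coordinates {A : E × F → E →L[ℝ] F} {Ω : Set (E × F)} (hΩ : IsOpen Ω)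
    (hA : ContDiffOn ℝ ∞ A Ω) (hinv : ∀ y ∈ Ω, IsInvolutiveAt A y) {y₀ : E × F} (hy₀ : y₀ ∈ Ω) :
    ∃ ψ : OpenPartialHomeomorph (E × F) (E × F), y₀ ∈ ψ.source ∧ ψ.source ⊆ Ω ∧
      ContDiffOn ℝ ∞ ψ ψ.source ∧ ContDiffOn ℝ ∞ ψ.symm ψ.target ∧
      ∀ y ∈ ψ.source, ∀ v, (fderiv ℝ ψ y v).2 = 0 ↔ v.2 = A y v.1 := by
  have : CompleteSpace E := FiniteDimensional.complete ℝ E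
  have : CompleteSpace F := FiniteDimensional.complete ℝ F
  obtain ⟨g, hg, hgA⟩ := exists_contDiff_eventuallyEq hΩ hA hy₀
  obtain ⟨r, hr, hrB⟩ := Metric.mem_nhds_iff.1 (inter_mem (hΩ.mem_nhds hy₀) hgA)
  -- `A` is replaced by the globally smooth `g`, which agrees with it on a ball about `y₀`; only
  -- solutions staying in this ball are considered.
  have hginv : ∀ y ∈ Metric.ball y₀ r, IsInvolutiveAt g y := by
    intro y hy u v
    have h1 : fderiv ℝ g y = fderiv ℝ A y := by
      apply Filter.EventuallyEq.fderiv_eq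
      filter_upwards [Metric.isOpen_ball.mem_nhds hy] with z hz
      exact (hrB hz).2
    have h2 : g y = A y := (hrB hy).2
    rw [h1, h2]
    exact hinv y (hrB hy).1 u v
  let Y : E × (E × F) → E × F := fun z => (z.1, g z.2 z.1)
  have hY : ContDiff ℝ ∞ Y := contDiff_fst.prodMk ((hg.comp contDiff_snd).clm_apply contDiff_fst)
  have hYd : ∀ (w dw : E) (y v : E × F), fderiv ℝ Y (w, y) (dw, v) =
      (dw, fderiv ℝ g y v w + g y dw) := fderiv_graphField hg
  obtain ⟨W, Γ, hW, h0, hΓ, hΓ0, H⟩ := exists_smooth_solutions_hasDerivAt hY (p₀ := 0)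
    (fun y => by simp [Y]) y₀
  have hW' : IsOpen (W ∩ Γ ⁻¹' Metric.ball (ContinuousMap.const _ y₀) r) :=
    hΓ.continuousOn.isOpen_inter_preimage hW Metric.isOpen_ball
  have hball : ∀ q ∈ W ∩ Γ ⁻¹' Metric.ball (ContinuousMap.const _ y₀) r, ∀ s,
      curveExt (Γ q) s ∈ Metric.ball y₀ r := by
    intro q hq s
    exact lt_of_le_of_lt (ContinuousMap.dist_apply_le_dist (f := Γ q)
      (g := ContinuousMap.const _ y₀) (projIcc (-1) 1 (by norm_num) s)) hq.2
  have hIco : ∀ s ∈ Ico (0 : ℝ) 1, s ∈ Ioo (-1 : ℝ) 1 := fun s hs =>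
    ⟨by linarith [hs.1], hs.2⟩
  -- The variation of the solutions in the direction of the parameter is tangent to the
  -- distribution.
  have htan : ∀ q ∈ W ∩ Γ ⁻¹' Metric.ball (ContinuousMap.const _ y₀) r, ∀ dw : E,
      curveExt (fderiv ℝ Γ q (dw, 0)) 1 = (dw, g (curveExt (Γ q) 1) dw) := by
    intro q hq dw
    obtain ⟨-, hγ, hvar⟩ := H q hq.1
    obtain ⟨hδ0, hδ⟩ := hvar (dw, 0)
    set δ := curveExt (fderiv ℝ Γ q (dw, 0)) with hδdef
    set γ := curveExt (Γ q) with hγdef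
    have hδc : Continuous δ := continuous_curveExt _
    have hγc : Continuous γ := continuous_curveExt _
    have hδ1 : ∀ s ∈ Ioo (-1 : ℝ) 1, HasDerivAt (fun s => (δ s).1) dw s := by
      intro s hs
      have := (hδ s hs).fst
      rwa [hYd] at this
    have hδ2 : ∀ s ∈ Ioo (-1 : ℝ) 1, HasDerivAt (fun s => (δ s).2)
        (fderiv ℝ g (γ s) (δ s) q.1 + g (γ s) dw) s := by
      intro s hs
      have := (hδ s hs).snd
      rwa [hYd] at this
    have hfst : (δ 1).1 = dw := by
      have h1 := constant_of_has_deriv_right_zero (f := fun s => (δ s).1 - s • dw) (a := 0) (b := 1)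
        (by fun_prop) (fun s hs => by
          have := ((hδ1 s (hIco s hs)).sub ((hasDerivAt_id s).smul_const dw)).hasDerivWithinAt
            (s := Ici s)
          rw [one_smul, sub_self] at this
          exact this) 1 (by simp)
      simp only [hδ0, one_smul, zero_smul, sub_zero, Prod.fst_zero] at h1
      exact sub_eq_zero.1 h1
    have hgγ : ∀ s ∈ Ioo (-1 : ℝ) 1, HasDerivAt (fun s => g (γ s))
        (fderiv ℝ g (γ s) (q.1, g (γ s) q.1)) s := fun s hs =>
      HasFDerivAt.comp_hasDerivAt s ((hg.differentiable (by simp)) (γ s)).hasFDerivAt (hγ s hs)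
    -- The deviation from the graph satisfies a homogeneous linear equation; this is where
    -- involutivity is used.
    have hu : ∀ s ∈ Ioo (-1 : ℝ) 1, HasDerivAt (fun s => (δ s).2 - g (γ s) (δ s).1)
        (fderiv ℝ g (γ s) (0, (δ s).2 - g (γ s) (δ s).1) q.1) s := by
      intro s hs
      have h1 := (hδ2 s hs).sub ((hgγ s hs).clm_apply (hδ1 s hs))
      convert! h1 using 1
      have h2 : (0, (δ s).2 - g (γ s) (δ s).1) = δ s - ((δ s).1, g (γ s) (δ s).1) := by
        ext <;> simp
      rw [h2, map_sub, sub_apply, hginv _ (hball q hq s) (δ s).1 q.1]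
      abel
    have hgc : Continuous (fderiv ℝ g) := hg.continuous_fderiv (by simp)
    have hgγc : Continuous fun s => fderiv ℝ g (γ s) := hgc.comp hγc
    obtain ⟨K, hK⟩ := isCompact_Icc.exists_bound_of_continuousOn (s := Icc (0 : ℝ) 1)
      (E := E × F →L[ℝ] E →L[ℝ] F) (f := fun s => fderiv ℝ g (γ s)) (by exact hgγc.continuousOn)
    have hcont : Continuous fun s => (δ s).2 - g (γ s) (δ s).1 :=
      (continuous_snd.comp hδc).sub ((hg.continuous.comp hγc).clm_apply (continuous_fst.comp hδc))
    have hzero := eq_zero_of_abs_deriv_le_mul_abs_self_of_eq_zero_right (K := K * ‖q.1‖)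
      hcont.continuousOn (fun s hs => (hu s (hIco s hs)).hasDerivWithinAt) (by simp [hδ0])
      (fun s hs => by
        calc ‖fderiv ℝ g (γ s) (0, (δ s).2 - g (γ s) (δ s).1) q.1‖
            ≤ ‖fderiv ℝ g (γ s)‖ * ‖((0, (δ s).2 - g (γ s) (δ s).1) : E × F)‖ * ‖q.1‖ :=
              ContinuousLinearMap.le_opNorm₂ _ _ _
          _ ≤ K * ‖(δ s).2 - g (γ s) (δ s).1‖ * ‖q.1‖ := by
              have : ‖((0, (δ s).2 - g (γ s) (δ s).1) : E × F)‖ = ‖(δ s).2 - g (γ s) (δ s).1‖ := by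
                simp [Prod.norm_def]
              rw [this]
              gcongr
              exact hK s (Ico_subset_Icc_self hs)
          _ = K * ‖q.1‖ * ‖(δ s).2 - g (γ s) (δ s).1‖ := by ring) 1 (by simp)
    refine Prod.ext hfst ?_
    rw [sub_eq_zero.1 hzero, hfst]
  let i : E × F → E × (E × F) := fun z => (z.1, (y₀.1, z.2))
  have hi : ContDiff ℝ ∞ i := contDiff_fst.prodMk (contDiff_const.prodMk contDiff_snd)
  have hid : ∀ z, HasFDerivAt i ((ContinuousLinearMap.fst ℝ E F).prod
      ((0 : E × F →L[ℝ] E).prod (ContinuousLinearMap.snd ℝ E F))) z := fun z =>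
    hasFDerivAt_fst.prodMk ((hasFDerivAt_const _ _).prodMk hasFDerivAt_snd)
  set U := i ⁻¹' (W ∩ Γ ⁻¹' Metric.ball (ContinuousMap.const _ y₀) r) with hU
  have hUo : IsOpen U := hW'.preimage hi.continuous
  let Φ : E × F → E × F := fun z => curveExt (Γ (i z)) 1
  have hΦ : ContDiffOn ℝ ∞ Φ U :=
    (ContinuousLinearMap.contDiff (𝕜 := ℝ) (E := C(Icc (-1 : ℝ) 1, E × F)) (F := E × F)
      (ContinuousMap.evalCLM ℝ (projIcc (-1 : ℝ) 1 (by norm_num) 1))).comp_contDiffOn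
      (hΓ.comp hi.contDiffOn fun z hz => hz.1)
  have hΦd : ∀ z ∈ U, ∀ dz, fderiv ℝ Φ z dz =
      curveExt (fderiv ℝ Γ (i z) (dz.1, (0, dz.2))) 1 := by
    intro z hz dz
    have h1 : HasFDerivAt Γ (fderiv ℝ Γ (i z)) (i z) :=
      ((hΓ.contDiffAt (hW.mem_nhds hz.1)).differentiableAt (by simp)).hasFDerivAt
    have h3 := HasFDerivAt.comp z (ContinuousLinearMap.hasFDerivAt (𝕜 := ℝ)
      (E := C(Icc (-1 : ℝ) 1, E × F)) (F := E × F)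
      (ContinuousMap.evalCLM ℝ (projIcc (-1 : ℝ) 1 (by norm_num) 1)))
      (HasFDerivAt.comp z h1 (hid z))
    exact congrArg (fun L : E × F →L[ℝ] E × F => L dz) h3.fderiv
  have hΦtan : ∀ z ∈ U, ∀ dw, fderiv ℝ Φ z (dw, 0) = (dw, g (Φ z) dw) := by
    intro z hz dw
    rw [hΦd z hz]
    exact htan (i z) hz dw
  have ha : ((0 : E), y₀.2) ∈ U := by
    refine ⟨h0, ?_⟩
    change Γ (0, y₀) ∈ Metric.ball _ r
    rw [hΓ0]
    exact Metric.mem_ball_self hr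
  have hΦa : Φ (0, y₀.2) = y₀ := by
    change curveExt (Γ (0, y₀)) 1 = y₀
    rw [hΓ0]
    rfl
  -- For `w = 0` the solutions are constant, so `Φ (0, z) = (y₀.1, z)`.
  have hΦvert : ∀ ζ, fderiv ℝ Φ (0, y₀.2) (0, ζ) = (0, ζ) := by
    intro ζ
    rw [hΦd _ ha]
    obtain ⟨-, -, hvar⟩ := H (0, y₀) h0
    obtain ⟨hδ0, hδ⟩ := hvar (0, (0, ζ))
    have h1 := constant_of_has_deriv_right_zero (f := curveExt (fderiv ℝ Γ (0, y₀) (0, (0, ζ))))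
      (a := 0) (b := 1) (continuous_curveExt _).continuousOn (fun s hs => by
        have := (hδ s (hIco s hs)).hasDerivWithinAt (s := Ici s)
        simpa [hYd, Prod.mk_zero_zero] using this) 1 (by simp)
    exact h1.trans hδ0
  let L := ContinuousLinearEquiv.skewProd (ContinuousLinearEquiv.refl ℝ E)
    (ContinuousLinearEquiv.refl ℝ F) (g y₀)
  have hL : HasFDerivAt Φ (L : E × F →L[ℝ] E × F) (0, y₀.2) := by
    have hda := (hΦ.contDiffAt (hUo.mem_nhds ha)).differentiableAt (by simp)
    refine hda.hasFDerivAt.congr_fderiv ?_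
    refine ContinuousLinearMap.ext fun z => ?_
    have : z = (z.1, 0) + (0, z.2) := by simp
    conv_lhs => rw [this]
    rw [map_add, hΦtan _ ha, hΦvert, hΦa]
    change _ = (z.1, z.2 + g y₀ z.1)
    ext <;> simp [add_comm]
  obtain ⟨e, hae, heU, hee, hes, hed⟩ := exists_smooth_inverse hUo hΦ ha L hL
  have htarget : ∀ y ∈ e.target, y ∈ Metric.ball y₀ r := by
    intro y hy
    rw [← e.right_inv hy, hee]
    exact hball _ (heU (e.map_target hy)) 1
  refine ⟨e.symm, ?_, fun y hy => (hrB (htarget y hy)).1, hes, ?_, ?_⟩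
  · have := e.map_source hae
    rwa [hee, hΦa] at this
  · rw [OpenPartialHomeomorph.symm_symm, hee]
    exact hΦ.mono heU
  · intro y hy v
    have hy' : y ∈ e.target := hy
    have hqs : e.symm y ∈ e.source := e.map_target hy'
    obtain ⟨G, hG⟩ := hed _ hqs
    have hsymm : HasFDerivAt e.symm (G.symm : E × F →L[ℝ] E × F) y :=
      e.hasFDerivAt_symm hy' (by rw [hee]; exact hG)
    have hGtan : ∀ dw, G (dw, 0) = (dw, A y dw) := by
      intro dw
      have h1 := hΦtan _ (heU hqs) dw
      rw [hG.fderiv, ← hee, e.right_inv hy'] at h1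
      have h2 : g y = A y := (hrB (htarget y hy')).2
      rwa [h2] at h1
    rw [hsymm.fderiv]
    constructor
    · intro h
      have h1 : G (G.symm v) = v := G.apply_symm_apply v
      have h2 : G.symm v = ((G.symm v).1, 0) := Prod.ext rfl h
      rw [h2, hGtan] at h1
      rw [← h1]
    · intro h
      have h1 : v = G (v.1, 0) := by
        rw [hGtan, ← h]
      have h2 : G.symm v = (v.1, 0) := by
        rw [h1, G.symm_apply_apply, hGtan]
      change (G.symm v).2 = 0
      rw [h2]

end Flat

/-! ### Smooth coordinates with values in a vector space -/

section Coordinates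

variable {d : ℕ} {M : Type u} [TopologicalSpace M] [ChartedSpace (EuclideanSpace ℝ (Fin d)) M]
  {F : Type} [NormedAddCommGroup F] [NormedSpace ℝ F]
  {F' : Type} [NormedAddCommGroup F'] [NormedSpace ℝ F']

/-- `e` is a diffeomorphism from an open subset of `M` to an open subset of the vector space `F`. -/
structure IsSmoothCoord (d : ℕ) {M : Type u} [TopologicalSpace M]
    [ChartedSpace (EuclideanSpace ℝ (Fin d)) M] {F : Type} [NormedAddCommGroup F]
    [NormedSpace ℝ F] (e : OpenPartialHomeomorph M F) : Prop where
  contMDiffOn : ContMDiffOn (𝓡 d) 𝓘(ℝ, F) ∞ e e.source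
  contMDiffOn_symm : ContMDiffOn 𝓘(ℝ, F) (𝓡 d) ∞ e.symm e.target

namespace IsSmoothCoord

variable {e : OpenPartialHomeomorph M F}

theorem mdifferentiable (he : IsSmoothCoord d e) : e.MDifferentiable (𝓡 d) 𝓘(ℝ, F) :=
  ⟨he.contMDiffOn.mdifferentiableOn (by simp), he.contMDiffOn_symm.mdifferentiableOn (by simp)⟩

theorem mdifferentiableAt (he : IsSmoothCoord d e) {x : M} (hx : x ∈ e.source) :
    MDifferentiableAt (𝓡 d) 𝓘(ℝ, F) e x :=
  he.mdifferentiable.mdifferentiableAt hx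

theorem mdifferentiableAt_symm (he : IsSmoothCoord d e) {y : F} (hy : y ∈ e.target) :
    MDifferentiableAt 𝓘(ℝ, F) (𝓡 d) e.symm y :=
  he.mdifferentiable.mdifferentiableAt_symm hy

theorem symm_mfderiv_mfderiv (he : IsSmoothCoord d e) {x : M} (hx : x ∈ e.source)
    (v : TangentSpace (𝓡 d) x) :
    mfderiv 𝓘(ℝ, F) (𝓡 d) e.symm (e x) (mfderiv (𝓡 d) 𝓘(ℝ, F) e x v) = v :=
  congrArg (fun L : TangentSpace (𝓡 d) x →L[ℝ] TangentSpace (𝓡 d) x => L v)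
    (he.mdifferentiable.symm_comp_deriv hx)

theorem mfderiv_symm_mfderiv (he : IsSmoothCoord d e) {y : F} (hy : y ∈ e.target) (v : F) :
    mfderiv (𝓡 d) 𝓘(ℝ, F) e (e.symm y) (mfderiv 𝓘(ℝ, F) (𝓡 d) e.symm y v) = v :=
  congrArg (fun L : F →L[ℝ] F => L v) (he.mdifferentiable.comp_symm_deriv hy)

theorem mfderiv_injective (he : IsSmoothCoord d e) {x : M} (hx : x ∈ e.source) :
    Function.Injective (mfderiv (𝓡 d) 𝓘(ℝ, F) e x) :=
  he.mdifferentiable.mfderiv_injective hx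

theorem restrOpen (he : IsSmoothCoord d e) {s : Set M} (hs : IsOpen s) :
    IsSmoothCoord d (e.restrOpen s hs) :=
  ⟨he.contMDiffOn.mono inter_subset_left,
    he.contMDiffOn_symm.mono fun _ hy => hy.1⟩

theorem trans (he : IsSmoothCoord d e) {ψ : OpenPartialHomeomorph F F'}
    (hψ : ContDiffOn ℝ ∞ ψ ψ.source) (hψ' : ContDiffOn ℝ ∞ ψ.symm ψ.target) :
    IsSmoothCoord d (e.trans ψ) := by
  refine ⟨?_, ?_⟩
  · refine hψ.contMDiffOn.comp (he.contMDiffOn.mono ?_) fun x hx => ?_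
    · intro x hx
      simp only [mfld_simps] at hx
      exact hx.1
    · simp only [mfld_simps] at hx
      exact hx.2
  · refine he.contMDiffOn_symm.comp (hψ'.contMDiffOn.mono ?_) fun x hx => ?_
    · intro x hx
      simp only [mfld_simps] at hx
      exact hx.1
    · simp only [mfld_simps] at hx
      exact hx.2

theorem mfderiv_trans (he : IsSmoothCoord d e) {ψ : OpenPartialHomeomorph F F'}
    (hψ : ContDiffOn ℝ ∞ ψ ψ.source) {x : M} (hx : x ∈ (e.trans ψ).source)
    (v : TangentSpace (𝓡 d) x) :
    mfderiv (𝓡 d) 𝓘(ℝ, F') (e.trans ψ) x v =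
      fderiv ℝ ψ (e x) (mfderiv (𝓡 d) 𝓘(ℝ, F) e x v) := by
  simp only [mfld_simps] at hx
  have h1 : MDifferentiableAt 𝓘(ℝ, F) 𝓘(ℝ, F') ψ (e x) :=
    ((hψ.contDiffAt (ψ.open_source.mem_nhds hx.2)).differentiableAt (by simp)).mdifferentiableAt
  have h2 := mfderiv_comp x h1 (he.mdifferentiableAt hx.1)
  rw [mfderiv_eq_fderiv] at h2
  exact congrArg (fun L : TangentSpace (𝓡 d) x →L[ℝ] F' => L v) h2

theorem of_chartAt [IsManifold (𝓡 d) ∞ M] (p : M) :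
    IsSmoothCoord d (chartAt (EuclideanSpace ℝ (Fin d)) p) :=
  ⟨contMDiffOn_chart, contMDiffOn_chart_symm⟩

end IsSmoothCoord

/-- The coordinate expression of the vector field `X` with respect to the coordinates `e`. -/
def coordField (e : OpenPartialHomeomorph M F) (X : (x : M) → TangentSpace (𝓡 d) x) (y : F) : F :=
  mfderiv (𝓡 d) 𝓘(ℝ, F) e (e.symm y) (X (e.symm y))

theorem coordField_apply {e : OpenPartialHomeomorph M F} (X : (x : M) → TangentSpace (𝓡 d) x)
    {x : M} (hx : x ∈ e.source) : coordField e X (e x) = mfderiv (𝓡 d) 𝓘(ℝ, F) e x (X x) := by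
  simp only [coordField]
  rw [e.left_inv hx]

/-- The vector field on the domain of `e` with coordinate expression `Y`. -/
def pullField (e : OpenPartialHomeomorph M F) (Y : F → F) (x : M) : TangentSpace (𝓡 d) x :=
  mfderiv 𝓘(ℝ, F) (𝓡 d) (e.symm : F → M) (e x) (Y (e x))

theorem coordField_pullField {e : OpenPartialHomeomorph M F} (he : IsSmoothCoord d e) (Y : F → F)
    {y : F} (hy : y ∈ e.target) :
    coordField e (pullField (d := d) e Y) y = Y y := by
  have h1 := he.mfderiv_symm_mfderiv hy (Y y)
  unfold coordField pullField
  rw [e.right_inv hy]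
  exact h1

variable [IsManifold (𝓡 d) ∞ M] {e : OpenPartialHomeomorph M F}

theorem contDiffOn_coordField (he : IsSmoothCoord d e) {X : (x : M) → TangentSpace (𝓡 d) x}
    {U : Set M} (hX : ContMDiffOn (𝓡 d) (𝓡 d).tangent ∞
      (fun x => (⟨x, X x⟩ : TangentBundle (𝓡 d) M)) U) :
    ContDiffOn ℝ ∞ (coordField e X) (e.target ∩ e.symm ⁻¹' U) := by
  have h1 := he.contMDiffOn.contMDiffOn_tangentMapWithin (m := ∞) (by simp)
    e.open_source.uniqueMDiffOn
  have h2 : ContMDiffOn 𝓘(ℝ, F) (𝓡 d).tangent ∞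
      (fun y => (⟨e.symm y, X (e.symm y)⟩ : TangentBundle (𝓡 d) M)) (e.target ∩ e.symm ⁻¹' U) :=
    hX.comp (he.contMDiffOn_symm.mono inter_subset_left) fun y hy => hy.2
  have h3 := h1.comp h2 (fun y hy => e.map_target hy.1)
  refine (contMDiffOn_vectorSpace_iff_contDiffOn (V := coordField e X)).1 ?_
  refine h3.congr fun y hy => ?_
  have h4 : e.symm y ∈ e.source := e.map_target hy.1
  simp only [Function.comp_apply, tangentMapWithin, coordField]
  rw [mfderivWithin_of_isOpen e.open_source h4]
  exact congrArg (fun z => (⟨z, mfderiv (𝓡 d) 𝓘(ℝ, F) e (e.symm y) (X (e.symm y))⟩ :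
    TangentBundle 𝓘(ℝ, F) F)) (e.right_inv hy.1).symm

theorem contMDiffOn_pullField (he : IsSmoothCoord d e) {Y : F → F}
    (hY : ContDiffOn ℝ ∞ Y e.target) :
    ContMDiffOn (𝓡 d) (𝓡 d).tangent ∞
      (fun x => (⟨x, pullField e Y x⟩ : TangentBundle (𝓡 d) M)) e.source := by
  have h1 := he.contMDiffOn_symm.contMDiffOn_tangentMapWithin (m := ∞) (by simp)
    e.open_target.uniqueMDiffOn
  have h2 : ContMDiffOn (𝓡 d) 𝓘(ℝ, F).tangent ∞
      (fun x => (⟨e x, Y (e x)⟩ : TangentBundle 𝓘(ℝ, F) F)) e.source :=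
    ContMDiffOn.comp (g := fun y => (⟨y, Y y⟩ : TangentBundle 𝓘(ℝ, F) F))
      (contMDiffOn_vectorSpace_iff_contDiffOn.2 hY) he.contMDiffOn e.mapsTo
  have h3 := h1.comp h2 (fun x hx => e.map_source hx)
  refine h3.congr fun x hx => ?_
  simp only [Function.comp_apply, tangentMapWithin, pullField]
  rw [mfderivWithin_of_isOpen e.open_target (e.map_source hx), e.left_inv hx]

/-- A vector field given in coordinates can be cut off to a global one. -/
theorem exists_smooth_cutoff_pullField [T2Space M] (he : IsSmoothCoord d e) {Y : F → F}
    (hY : ContDiffOn ℝ ∞ Y e.target) {p : M} (hp : p ∈ e.source) :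
    ∃ (χ : M → ℝ), IsSmoothVectorField (fun x => χ x • pullField (d := d) e Y x) ∧
      (∀ᶠ x in 𝓝 p, χ x = 1) ∧ ∀ x, x ∉ e.source → χ x = 0 := by
  obtain ⟨f, -, hf⟩ := (SmoothBumpFunction.nhds_basis_tsupport (I := 𝓡 d) p).mem_iff.1
    (e.open_source.mem_nhds hp)
  refine ⟨f, ?_, f.eventuallyEq_one, fun x hx => ?_⟩
  · exact ContMDiffOn.smul_section_of_tsupport (n := ∞) (V := fun x : M => TangentSpace (𝓡 d) x)
      (ψ := f) (s := pullField e Y) f.contMDiff.contMDiffOn e.open_source hf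
      (contMDiffOn_pullField he hY)
  · exact image_eq_zero_of_notMem_tsupport fun h => hx (hf h)

end Coordinates

/-! ### Charts adapted to a distribution -/

/-- A subspace of dimension `m` in a space of dimension `m + n` can be moved to the first factor of
`ℝᵐ × ℝⁿ`. -/
theorem exists_equiv_prod_of_finrank {m n : ℕ} (S : Submodule ℝ (EuclideanSpace ℝ (Fin (m + n))))
    (hS : Module.finrank ℝ S = m) :
    ∃ L : EuclideanSpace ℝ (Fin (m + n)) ≃L[ℝ]
      EuclideanSpace ℝ (Fin m) × EuclideanSpace ℝ (Fin n), ∀ v ∈ S, (L v).2 = 0 := by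
  obtain ⟨T, hT⟩ := S.exists_isCompl
  have h1 := Submodule.finrank_add_eq_of_isCompl hT
  rw [hS, finrank_euclideanSpace_fin] at h1
  have hT' : Module.finrank ℝ T = n := by omega
  let a : S ≃ₗ[ℝ] EuclideanSpace ℝ (Fin m) := LinearEquiv.ofFinrankEq _ _ (by simp [hS])
  let b : T ≃ₗ[ℝ] EuclideanSpace ℝ (Fin n) := LinearEquiv.ofFinrankEq _ _ (by simp [hT'])
  let L := (S.prodEquivOfIsCompl T hT).symm.trans (LinearEquiv.prodCongr a b)
  refine ⟨L.toContinuousLinearEquiv, fun v hv => ?_⟩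
  change b ((S.prodEquivOfIsCompl T hT).symm v).2 = 0
  rw [(Submodule.prodEquivOfIsCompl_symm_apply_snd_eq_zero S T hT).2 hv, map_zero]

section Charts

variable {m n : ℕ} {M : Type u} [TopologicalSpace M]
  [ChartedSpace (EuclideanSpace ℝ (Fin (m + n))) M] [IsManifold (𝓡 (m + n)) ∞ M]

/-- The coordinates `e` turn the distribution `D` into the distribution of graphs of `A`. -/
structure IsGraphChart (D : TangentDistribution m n M)
    (e : OpenPartialHomeomorph M (EuclideanSpace ℝ (Fin m) × EuclideanSpace ℝ (Fin n)))
    (A : EuclideanSpace ℝ (Fin m) × EuclideanSpace ℝ (Fin n) →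
      EuclideanSpace ℝ (Fin m) →L[ℝ] EuclideanSpace ℝ (Fin n)) : Prop where
  isSmoothCoord : IsSmoothCoord (m + n) e
  contDiffOn : ContDiffOn ℝ ∞ A e.target
  mem_iff : ∀ x ∈ e.source, ∀ v : TangentSpace (𝓡 (m + n)) x, v ∈ D.space x ↔
    (mfderiv (𝓡 (m + n)) 𝓘(ℝ, EuclideanSpace ℝ (Fin m) × EuclideanSpace ℝ (Fin n)) e x v).2 =
      A (e x)
      (mfderiv (𝓡 (m + n)) 𝓘(ℝ, EuclideanSpace ℝ (Fin m) × EuclideanSpace ℝ (Fin n)) e x v).1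

/-- The coordinates `e` turn the distribution `D` into the distribution of the subspaces
`ℝᵐ × 0`. -/
structure IsFlatChart (D : TangentDistribution m n M)
    (e : OpenPartialHomeomorph M (EuclideanSpace ℝ (Fin m) × EuclideanSpace ℝ (Fin n))) :
    Prop where
  isSmoothCoord : IsSmoothCoord (m + n) e
  mem_iff : ∀ x ∈ e.source, ∀ v : TangentSpace (𝓡 (m + n)) x, v ∈ D.space x ↔
    (mfderiv (𝓡 (m + n)) 𝓘(ℝ, EuclideanSpace ℝ (Fin m) × EuclideanSpace ℝ (Fin n)) e x v).2 = 0

/-- Every point of `M` is in the domain of a flat chart of `D`. -/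
def HasFlatCharts (D : TangentDistribution m n M) : Prop :=
  ∀ p : M, ∃ e, IsFlatChart D e ∧ p ∈ e.source

/-- Every smooth distribution is locally a distribution of graphs. -/
theorem exists_isGraphChart (D : TangentDistribution m n M) (p : M) :
    ∃ e A, IsGraphChart D e A ∧ p ∈ e.source := by
  set φ := chartAt (EuclideanSpace ℝ (Fin (m + n))) p with hφ
  have hφs : IsSmoothCoord (m + n) φ := IsSmoothCoord.of_chartAt p
  have hpφ : p ∈ φ.source := mem_chart_source _ p
  obtain ⟨U, hU, hpU, X, hX, hspan⟩ := D.smooth p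
  let S : Submodule ℝ (EuclideanSpace ℝ (Fin (m + n))) := (D.space p).map
    (mfderiv (𝓡 (m + n)) 𝓘(ℝ, EuclideanSpace ℝ (Fin (m + n))) φ p).toLinearMap
  have hS : Module.finrank ℝ S = m :=
    (Submodule.equivMapOfInjective _ (hφs.mfderiv_injective hpφ) _).finrank_eq.symm.trans
      (D.finrank_space p)
  obtain ⟨L, hL⟩ := exists_equiv_prod_of_finrank S hS
  let ψ := L.toHomeomorph.toOpenPartialHomeomorph
  have hψ : ContDiffOn ℝ ∞ ψ ψ.source := L.contDiff.contDiffOn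
  have hψ' : ContDiffOn ℝ ∞ ψ.symm ψ.target := L.symm.contDiff.contDiffOn
  let e₀ := φ.trans ψ
  have he₀ : IsSmoothCoord (m + n) e₀ := hφs.trans hψ hψ'
  have hp₀ : p ∈ e₀.source := by
    simp only [e₀, ψ, mfld_simps]
    exact hpφ
  set Ω := e₀.target ∩ e₀.symm ⁻¹' U with hΩ
  have hΩo : IsOpen Ω := e₀.isOpen_inter_preimage_symm hU
  have hXc : ∀ i, ContDiffOn ℝ ∞ (coordField e₀ (X i)) Ω := fun i =>
    contDiffOn_coordField he₀ (hX i)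
  -- `R y` sends the `i`-th basis vector to the `i`-th spanning vector field at `y`.
  let R : EuclideanSpace ℝ (Fin m) × EuclideanSpace ℝ (Fin n) → EuclideanSpace ℝ (Fin m) →L[ℝ]
      EuclideanSpace ℝ (Fin m) × EuclideanSpace ℝ (Fin n) := fun y =>
    ∑ i, (EuclideanSpace.proj i : EuclideanSpace ℝ (Fin m) →L[ℝ] ℝ).smulRight
      (coordField e₀ (X i) y)
  have hRs : ContDiffOn ℝ ∞ R Ω := ContDiffOn.sum fun i _ => contDiffOn_const.smulRight (hXc i)
  have hR : ∀ x ∈ e₀.source, ∀ c, R (e₀ x) c = mfderiv (𝓡 (m + n))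
      𝓘(ℝ, EuclideanSpace ℝ (Fin m) × EuclideanSpace ℝ (Fin n)) e₀ x (∑ i, c i • X i x) := by
    intro x hx c
    rw [map_sum]
    simp only [R, sum_apply, coordField_apply _ hx, map_smul]
    rfl
  have hmem : ∀ x ∈ U, ∀ v, v ∈ D.space x ↔
      ∃ c : EuclideanSpace ℝ (Fin m), ∑ i, c i • X i x = v := by
    intro x hx v
    rw [hspan x hx, Submodule.mem_span_range_iff_exists_fun]
    exact ⟨fun ⟨c, hc⟩ => ⟨WithLp.toLp 2 c, hc⟩, fun ⟨c, hc⟩ => ⟨c, hc⟩⟩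
  -- Where the first component `P` of `R` is invertible, the range of `R` is the graph of `Q ∘ P⁻¹`.
  let P : EuclideanSpace ℝ (Fin m) × EuclideanSpace ℝ (Fin n) →
      EuclideanSpace ℝ (Fin m) →L[ℝ] EuclideanSpace ℝ (Fin m) := fun y =>
    ContinuousLinearMap.fst ℝ _ _ ∘L R y
  let Q : EuclideanSpace ℝ (Fin m) × EuclideanSpace ℝ (Fin n) →
      EuclideanSpace ℝ (Fin m) →L[ℝ] EuclideanSpace ℝ (Fin n) := fun y =>
    ContinuousLinearMap.snd ℝ _ _ ∘L R y
  have hP : ContDiffOn ℝ ∞ P Ω := contDiffOn_const.clm_comp hRs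
  have hQ : ContDiffOn ℝ ∞ Q Ω := contDiffOn_const.clm_comp hRs
  set Ω' := Ω ∩ P ⁻¹' range ((↑) : (EuclideanSpace ℝ (Fin m) ≃L[ℝ] EuclideanSpace ℝ (Fin m)) →
    EuclideanSpace ℝ (Fin m) →L[ℝ] EuclideanSpace ℝ (Fin m)) with hΩ'
  have hΩo' : IsOpen Ω' := hP.continuousOn.isOpen_inter_preimage hΩo ContinuousLinearEquiv.isOpen
  have hpΩ : e₀ p ∈ Ω' := by
    refine ⟨⟨e₀.map_source hp₀, ?_⟩, ?_⟩
    · rw [mem_preimage, e₀.left_inv hp₀]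
      exact hpU
    have hind : LinearIndependent ℝ fun i => X i p := by
      rw [linearIndependent_iff_card_eq_finrank_span, Fintype.card_fin]
      have h1 := D.finrank_space p
      rw [hspan p hpU] at h1
      exact h1.symm
    have hinj : Function.Injective (P (e₀ p)) := by
      rw [injective_iff_map_eq_zero]
      intro c hc
      have h1 : (R (e₀ p) c).1 = 0 := hc
      have h2 : (R (e₀ p) c).2 = 0 := by
        rw [hR p hp₀, hφs.mfderiv_trans hψ hp₀]
        have h3 : fderiv ℝ ψ (φ p) = (L : _ →L[ℝ] _) := L.fderiv
        rw [h3]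
        exact hL _ (Submodule.mem_map_of_mem ((hmem p hpU _).2 ⟨c, rfl⟩))
      have h4 : R (e₀ p) c = 0 := Prod.ext h1 h2
      rw [hR p hp₀] at h4
      have h5 := (injective_iff_map_eq_zero _).1 (he₀.mfderiv_injective hp₀) _ h4
      ext i
      exact Fintype.linearIndependent_iff.1 hind (fun i => c i) h5 i
    exact ⟨(LinearEquiv.ofInjectiveEndo (P (e₀ p)).toLinearMap hinj).toContinuousLinearEquiv,
      by ext; rfl⟩
  have hs : IsOpen (e₀.source ∩ e₀ ⁻¹' Ω') := e₀.isOpen_inter_preimage hΩo'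
  refine ⟨e₀.restrOpen _ hs, fun y => Q y ∘L (P y).inverse, ⟨he₀.restrOpen hs, ?_, ?_⟩,
    hp₀, hp₀, hpΩ⟩
  · intro y hy
    have hy1 : y ∈ e₀.target := hy.1
    have hy2 : y ∈ Ω' := by
      have : e₀ (e₀.symm y) ∈ Ω' := hy.2.2
      rwa [e₀.right_inv hy1] at this
    obtain ⟨g, hg⟩ := hy2.2
    have h1 : ContDiffAt ℝ ∞ ContinuousLinearMap.inverse (P y) := by
      rw [← hg]
      exact contDiffAt_map_inverse g
    exact ((hQ.contDiffAt (hΩo.mem_nhds hy2.1)).clm_comp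
      (h1.comp y (hP.contDiffAt (hΩo.mem_nhds hy2.1)))).contDiffWithinAt
  · intro x hx v
    have hx1 : x ∈ e₀.source := hx.1
    have hx2 : e₀ x ∈ Ω' := hx.2.2
    have hxU : x ∈ U := by
      have : e₀.symm (e₀ x) ∈ U := hx2.1.2
      rwa [e₀.left_inv hx1] at this
    obtain ⟨g, hg⟩ := hx2.2
    change _ ↔ (mfderiv (𝓡 (m + n)) 𝓘(ℝ, EuclideanSpace ℝ (Fin m) × EuclideanSpace ℝ (Fin n))
      e₀ x v).2 = Q (e₀ x) ((P (e₀ x)).inverse (mfderiv (𝓡 (m + n))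
        𝓘(ℝ, EuclideanSpace ℝ (Fin m) × EuclideanSpace ℝ (Fin n)) e₀ x v).1)
    rw [← hg, ContinuousLinearMap.inverse_equiv, hmem x hxU]
    constructor
    · rintro ⟨c, rfl⟩
      rw [← hR x hx1]
      have h1 : (R (e₀ x) c).1 = g c := congrArg (fun B => B c) hg.symm
      rw [h1]
      change _ = Q (e₀ x) (g.symm (g c))
      rw [g.symm_apply_apply]
      rfl
    · intro h
      refine ⟨g.symm (mfderiv (𝓡 (m + n))
        𝓘(ℝ, EuclideanSpace ℝ (Fin m) × EuclideanSpace ℝ (Fin n)) e₀ x v).1, ?_⟩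
      apply he₀.mfderiv_injective hx1
      rw [← hR x hx1]
      refine Prod.ext ?_ h.symm
      have h1 : ∀ c, (R (e₀ x) c).1 = g c := fun c => congrArg (fun B => B c) hg.symm
      rw [h1, g.apply_symm_apply]

/-- Where a distribution of graphs is involutive it admits flat charts. -/
theorem IsGraphChart.exists_isFlatChart {D : TangentDistribution m n M}
    {e : OpenPartialHomeomorph M (EuclideanSpace ℝ (Fin m) × EuclideanSpace ℝ (Fin n))}
    {A : EuclideanSpace ℝ (Fin m) × EuclideanSpace ℝ (Fin n) →
      EuclideanSpace ℝ (Fin m) →L[ℝ] EuclideanSpace ℝ (Fin n)} (he : IsGraphChart D e A)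
    (hinv : ∀ x ∈ e.source, IsInvolutiveAt A (e x)) {p : M} (hp : p ∈ e.source) :
    ∃ e', IsFlatChart D e' ∧ p ∈ e'.source := by
  obtain ⟨ψ, hpψ, hψs, hψ, hψ', hiff⟩ := exists_flat_coordinates e.open_target he.contDiffOn
    (fun y hy => by
      have := hinv _ (e.map_target hy)
      rwa [e.right_inv hy] at this) (e.map_source hp)
  refine ⟨e.trans ψ, ⟨he.isSmoothCoord.trans hψ hψ', fun x hx v => ?_⟩, ?_⟩
  · rw [he.isSmoothCoord.mfderiv_trans hψ hx]
    simp only [mfld_simps] at hx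
    exact (he.mem_iff x hx.1 v).trans (hiff _ hx.2 _).symm
  · simp only [mfld_simps]
    exact ⟨hp, hpψ⟩

end Charts

/-! ### The flow of a vector field on a manifold -/

section ManifoldFlow

variable {d : ℕ} {M : Type u} [TopologicalSpace M] [ChartedSpace (EuclideanSpace ℝ (Fin d)) M]
  {X : (x : M) → TangentSpace (𝓡 d) x}

section Group

variable [IsManifold (𝓡 d) ∞ M] [T2Space M]

/-- The flow has the group property wherever both maps are defined: two integral curves can be
concatenated. -/
theorem flowMap_add (hX : IsSmoothVectorField X) {x : M} {s h : ℝ} (hs : x ∈ flowDomain X s)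
    (hh : flowMap X s x ∈ flowDomain X h) :
    x ∈ flowDomain X (s + h) ∧ flowMap X (s + h) x = flowMap X h (flowMap X s x) := by
  obtain ⟨γ, hγ⟩ := hs
  obtain ⟨η, hη⟩ := hh
  have e1 := flowMap_eq hX hγ
  have e2 := flowMap_eq hX hη
  obtain ⟨hγ0, a, b, h0ab, hsab, hγc⟩ := hγ
  obtain ⟨hη0, a', b', h0ab', hhab', hηc⟩ := hη
  have hηs : IsMIntegralCurveOn (η ∘ (· - s)) X (Ioo (a' + s) (b' + s)) := by
    have := (isMIntegralCurveOn_comp_sub (dt := s)).2 hηc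
    convert! this using 1
    ext t
    simp only [mem_Ioo, mem_ofPred_eq]
    constructor <;> rintro ⟨h1, h2⟩ <;> constructor <;> linarith
  have hov : s ∈ Ioo a b ∩ Ioo (a' + s) (b' + s) :=
    ⟨hsab, by linarith [h0ab'.1], by linarith [h0ab'.2]⟩
  have hagree : γ s = (η ∘ (· - s)) s := by
    simp [hη0, e1]
  have hX1 : ContMDiff (𝓡 d) (𝓡 d).tangent 1
      (fun x => (⟨x, X x⟩ : TangentBundle (𝓡 d) M)) := ContMDiff.of_le hX (by norm_num)
  have hpw := isMIntegralCurveOn_piecewise hX1 hγc hηs hov hagree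
  have heq := eqOn_piecewise_of_isMIntegralCurveOn_Ioo hX1 hγc hηs hov hagree
  have hcurve : IsIntegralCurveFromTo X x (s + h) (piecewise (Ioo a b) γ (η ∘ (· - s))) := by
    refine ⟨by rw [piecewise_eq_of_mem _ _ _ h0ab, hγ0], min a (a' + s), max b (b' + s),
      ⟨min_lt_of_left_lt h0ab.1, lt_max_of_lt_left h0ab.2⟩,
      ⟨min_lt_of_right_lt (by linarith [hhab'.1]), lt_max_of_lt_right (by linarith [hhab'.2])⟩,
      hpw.mono fun t ht => ?_⟩
    rcases le_or_gt t s with hts | hts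
    · rcases min_lt_iff.1 ht.1 with h1 | h1
      · exact Or.inl ⟨h1, hts.trans_lt hsab.2⟩
      · exact Or.inr ⟨h1, hts.trans_lt hov.2.2⟩
    · rcases lt_max_iff.1 ht.2 with h1 | h1
      · exact Or.inl ⟨hsab.1.trans hts, h1⟩
      · exact Or.inr ⟨hov.2.1.trans hts, h1⟩
  refine ⟨⟨_, hcurve⟩, ?_⟩
  rw [flowMap_eq hX hcurve, e2, heq ⟨by linarith [hhab'.1], by linarith [hhab'.2]⟩]
  simp

theorem flowMap_neg (hX : IsSmoothVectorField X) {x : M} {t : ℝ} (ht : x ∈ flowDomain X t) :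
    flowMap X t x ∈ flowDomain X (-t) ∧ flowMap X (-t) (flowMap X t x) = x := by
  obtain ⟨γ, hγ⟩ := ht
  have e1 := flowMap_eq hX hγ
  obtain ⟨hγ0, a, b, h0ab, htab, hγc⟩ := hγ
  have hc : IsIntegralCurveFromTo X (flowMap X t x) (-t) (γ ∘ (· + t)) := by
    refine ⟨by simp [e1], a - t, b - t, ⟨by linarith [htab.1], by linarith [htab.2]⟩,
      ⟨by linarith [h0ab.1], by linarith [h0ab.2]⟩, ?_⟩
    have := hγc.comp_add t
    convert! this using 1
    ext s
    simp only [mem_Ioo, mem_ofPred_eq]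
    constructor <;> rintro ⟨h1, h2⟩ <;> constructor <;> linarith
  refine ⟨⟨_, hc⟩, ?_⟩
  rw [flowMap_eq hX hc]
  simp [hγ0]

end Group

variable {F : Type} [NormedAddCommGroup F] [NormedSpace ℝ F] {e : OpenPartialHomeomorph M F}

/-- Integral curves of the coordinate expression of a vector field are integral curves. -/
theorem isMIntegralCurveOn_symm_comp (he : IsSmoothCoord d e) {c : ℝ → F} {s : Set ℝ}
    (hc : ∀ t ∈ s, c t ∈ e.target ∧ HasDerivAt c (coordField e X (c t)) t) :
    IsMIntegralCurveOn (e.symm ∘ c) X s := by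
  intro t ht
  obtain ⟨h1, h2⟩ := hc t ht
  have h3 : HasMFDerivAt 𝓘(ℝ, ℝ) 𝓘(ℝ, F) c t _ := h2.hasFDerivAt.hasMFDerivAt
  have h4 := (he.mdifferentiableAt_symm h1).hasMFDerivAt.comp t h3
  refine h4.hasMFDerivWithinAt.congr_mfderiv ?_
  refine ContinuousLinearMap.ext fun (r : ℝ) => ?_
  have h5 := he.symm_mfderiv_mfderiv (e.map_target h1) (X (e.symm (c t)))
  rw [e.right_inv h1] at h5
  let L : F →L[ℝ] TangentSpace (𝓡 d) (e.symm (c t)) := mfderiv 𝓘(ℝ, F) (𝓡 d) e.symm (c t)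
  exact (L.map_smul r (coordField e X (c t))).trans
    (congrArg (fun w : TangentSpace (𝓡 d) (e.symm (c t)) => r • w) h5)

/-- On the open set `W` and for times in `(-ε, ε)` the flow of `X` is defined and has the expression
`Φ` in the coordinates `e`. -/
structure IsLocalFlow (X : (x : M) → TangentSpace (𝓡 d) x) (e : OpenPartialHomeomorph M F) (ε : ℝ)
    (W : Set M) (Φ : ℝ → F → F) : Prop where
  pos : 0 < ε
  isOpen : IsOpen W
  subset_source : W ⊆ e.source
  zero : ∀ x ∈ W, Φ 0 (e x) = e x
  mem_target : ∀ x ∈ W, ∀ t ∈ Ioo (-ε) ε, Φ t (e x) ∈ e.target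
  mem_flowDomain : ∀ x ∈ W, ∀ t ∈ Ioo (-ε) ε, x ∈ flowDomain X t
  flowMap_eq : ∀ x ∈ W, ∀ t ∈ Ioo (-ε) ε, flowMap X t x = e.symm (Φ t (e x))
  differentiableAt : ∀ x ∈ W, ∀ t ∈ Ioo (-ε) ε, DifferentiableAt ℝ (Φ t) (e x)
  hasDerivAt : ∀ x ∈ W, ∀ t ∈ Ioo (-ε) ε,
    HasDerivAt (fun t => Φ t (e x)) (coordField e X (Φ t (e x))) t
  hasDerivAt_fderiv : ∀ x ∈ W, ∀ t ∈ Ioo (-ε) ε, ∀ v : F,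
    HasDerivAt (fun t => fderiv ℝ (Φ t) (e x) v)
      (fderiv ℝ (coordField e X) (Φ t (e x)) (fderiv ℝ (Φ t) (e x) v)) t

/-- Near each point and for small times, the flow of a smooth vector field is defined, stays in a
given neighbourhood, and has the expected coordinate expression. -/
theorem exists_isLocalFlow [IsManifold (𝓡 d) ∞ M] [T2Space M] [FiniteDimensional ℝ F]
    (hX : IsSmoothVectorField X) (he : IsSmoothCoord d e) {O : Set M} (hO : IsOpen O) {p : M}
    (hp : p ∈ e.source) (hpO : p ∈ O) :
    ∃ ε W Φ, IsLocalFlow X e ε W Φ ∧ p ∈ W ∧ ∀ x ∈ W, ∀ t ∈ Ioo (-ε) ε, flowMap X t x ∈ O := by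
  have hXs : ContDiffOn ℝ ∞ (coordField e X) (e.target ∩ e.symm ⁻¹' O) :=
    contDiffOn_coordField he (ContMDiff.contMDiffOn hX)
  obtain ⟨ε, B, Φ, hε, hB, hpB, h0, hs, h⟩ := exists_smooth_local_flow
    (e.isOpen_inter_preimage_symm hO) hXs (y₀ := e p)
    ⟨e.map_source hp, by rwa [mem_preimage, e.left_inv hp]⟩
  have hcurve : ∀ x ∈ e.source ∩ e ⁻¹' B, ∀ t ∈ Ioo (-ε) ε,
      IsIntegralCurveFromTo X x t (e.symm ∘ fun t => Φ t (e x)) := by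
    intro x hx t ht
    refine ⟨?_, -ε, ε, ⟨by linarith, hε⟩, ht, isMIntegralCurveOn_symm_comp he fun s hs =>
      ⟨(h _ hx.2 s hs).1.1, (h _ hx.2 s hs).2.1⟩⟩
    simp only [Function.comp_apply]
    rw [h0 _ hx.2, e.left_inv hx.1]
  have hfl : ∀ x ∈ e.source ∩ e ⁻¹' B, ∀ t ∈ Ioo (-ε) ε, flowMap X t x = e.symm (Φ t (e x)) :=
    fun x hx t ht => _root_.flowMap_eq hX (hcurve x hx t ht)
  refine ⟨ε, e.source ∩ e ⁻¹' B, Φ, ⟨hε, e.isOpen_inter_preimage hB, inter_subset_left,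
    fun x hx => h0 _ hx.2, fun x hx t ht => (h _ hx.2 t ht).1.1,
    fun x hx t ht => ⟨_, hcurve x hx t ht⟩, hfl, fun x hx t ht =>
      ((hs t ht).contDiffAt (hB.mem_nhds hx.2)).differentiableAt (by simp),
    fun x hx t ht => (h _ hx.2 t ht).2.1, fun x hx t ht => (h _ hx.2 t ht).2.2⟩, ⟨hp, hpB⟩,
    fun x hx t ht => ?_⟩
  rw [hfl x hx t ht]
  exact (h _ hx.2 t ht).1.2

namespace IsLocalFlow

variable {ε : ℝ} {W : Set M} {Φ : ℝ → F → F}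

theorem eventuallyEq (h : IsLocalFlow X e ε W Φ) {x : M} (hx : x ∈ W) {t : ℝ}
    (ht : t ∈ Ioo (-ε) ε) : flowMap X t =ᶠ[𝓝 x] e.symm ∘ Φ t ∘ e := by
  filter_upwards [h.isOpen.mem_nhds hx] with y hy
  exact h.flowMap_eq y hy t ht

theorem mdifferentiableAt (h : IsLocalFlow X e ε W Φ) (he : IsSmoothCoord d e) {x : M}
    (hx : x ∈ W) {t : ℝ} (ht : t ∈ Ioo (-ε) ε) :
    MDifferentiableAt (𝓡 d) (𝓡 d) (flowMap X t) x := by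
  refine MDifferentiableAt.congr_of_eventuallyEq ?_ (h.eventuallyEq hx ht)
  exact (he.mdifferentiableAt_symm (h.mem_target x hx t ht)).comp x
    ((h.differentiableAt x hx t ht).mdifferentiableAt.comp x
      (he.mdifferentiableAt (h.subset_source hx)))

theorem mfderiv_flowMap (h : IsLocalFlow X e ε W Φ) (he : IsSmoothCoord d e) {x : M}
    (hx : x ∈ W) {t : ℝ} (ht : t ∈ Ioo (-ε) ε) (v : TangentSpace (𝓡 d) x) :
    mfderiv (𝓡 d) 𝓘(ℝ, F) e (flowMap X t x) (mfderiv (𝓡 d) (𝓡 d) (flowMap X t) x v) =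
      fderiv ℝ (Φ t) (e x) (mfderiv (𝓡 d) 𝓘(ℝ, F) e x v) := by
  have hmem : flowMap X t x ∈ e.source := by
    rw [h.flowMap_eq x hx t ht]
    exact e.map_target (h.mem_target x hx t ht)
  have h1 := mfderiv_comp x (he.mdifferentiableAt hmem) (h.mdifferentiableAt he hx ht)
  have h2 := mfderiv_comp x (h.differentiableAt x hx t ht).mdifferentiableAt
    (he.mdifferentiableAt (h.subset_source hx))
  have h3 : e ∘ flowMap X t =ᶠ[𝓝 x] Φ t ∘ e := by
    filter_upwards [h.isOpen.mem_nhds hx] with y hy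
    simp only [Function.comp_apply]
    rw [h.flowMap_eq y hy t ht, e.right_inv (h.mem_target y hy t ht)]
  rw [mfderiv_eq_fderiv] at h2
  have h4 := h1.symm.trans (h3.mfderiv_eq.trans h2)
  exact congrArg (fun L : TangentSpace (𝓡 d) x →L[ℝ] F => L v) h4

end IsLocalFlow

end ManifoldFlow

/-! ### Symmetries, involutivity and flat charts -/

section Preservation

variable {m n : ℕ} {M : Type u} [TopologicalSpace M]
  [ChartedSpace (EuclideanSpace ℝ (Fin (m + n))) M] [IsManifold (𝓡 (m + n)) ∞ M]
  {D : TangentDistribution m n M}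

/-- In flat coordinates the flow of a vector field in `D` does not change the second component. -/
theorem IsFlatChart.snd_flow {e : OpenPartialHomeomorph M
      (EuclideanSpace ℝ (Fin m) × EuclideanSpace ℝ (Fin n))} (he : IsFlatChart D e)
    {X : (x : M) → TangentSpace (𝓡 (m + n)) x} (hX : X ∈ D.vectorFields) {ε : ℝ} {W : Set M}
    {Φ : ℝ → _ → _} (hΦ : IsLocalFlow X e ε W Φ) {x : M} (hx : x ∈ W) {t : ℝ}
    (ht : t ∈ Ioo (-ε) ε) : (Φ t (e x)).2 = (e x).2 := by
  have h0 : (0 : ℝ) ∈ Ioo (-ε) ε := ⟨by linarith [hΦ.pos], hΦ.pos⟩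
  have h1 : ∀ s ∈ Ioo (-ε) ε, HasDerivWithinAt (fun s => (Φ s (e x)).2) 0 (Ioo (-ε) ε) s := by
    intro s hs
    have h2 := (hasFDerivAt_snd (𝕜 := ℝ) (p := Φ s (e x))).comp_hasDerivAt s
      (hΦ.hasDerivAt x hx s hs)
    have h3 : (coordField e X (Φ s (e x))).2 = 0 :=
      (he.mem_iff _ (e.map_target (hΦ.mem_target x hx s hs)) _).1 (hX.2 _)
    exact (h2.congr_deriv h3).hasDerivWithinAt
  have h2 := (convex_Ioo (-ε) ε).norm_image_sub_le_of_norm_hasDerivWithin_le h1 (C := 0)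
    (fun s _ => by simp) h0 ht
  rw [zero_mul] at h2
  have h3 := sub_eq_zero.1 (norm_le_zero_iff.1 h2)
  simpa [hΦ.zero x hx] using h3

variable [T2Space M]

/-- If the flows of all vector fields in `D` preserve `D`, then `D` is involutive. This follows by
differentiating at time zero the condition that the flow of `(u, A u)` maps the vector `(v, A v)`
into `D`. -/
theorem IsGraphChart.isInvolutiveAt_of_vectorFields_subset (hD : D.vectorFields ⊆ D.symmetries)
    {e : OpenPartialHomeomorph M (EuclideanSpace ℝ (Fin m) × EuclideanSpace ℝ (Fin n))}
    {A : EuclideanSpace ℝ (Fin m) × EuclideanSpace ℝ (Fin n) →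
      EuclideanSpace ℝ (Fin m) →L[ℝ] EuclideanSpace ℝ (Fin n)} (he : IsGraphChart D e A)
    {x : M} (hx : x ∈ e.source) : IsInvolutiveAt A (e x) := by
  intro u v
  have hs := he.isSmoothCoord
  let Y : EuclideanSpace ℝ (Fin m) × EuclideanSpace ℝ (Fin n) →
      EuclideanSpace ℝ (Fin m) × EuclideanSpace ℝ (Fin n) := fun y => (u, A y u)
  have hY : ContDiffOn ℝ ∞ Y e.target :=
    contDiffOn_const.prodMk (he.contDiffOn.clm_apply contDiffOn_const)
  obtain ⟨χ, hχs, hχ1, hχ0⟩ := exists_smooth_cutoff_pullField hs hY hx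
  set X : (x : M) → TangentSpace (𝓡 (m + n)) x := fun x => χ x • pullField e Y x with hXdef
  have hXY : ∀ z ∈ e.source, mfderiv (𝓡 (m + n))
      𝓘(ℝ, EuclideanSpace ℝ (Fin m) × EuclideanSpace ℝ (Fin n)) e z (pullField e Y z) =
        Y (e z) := by
    intro z hz
    rw [← coordField_apply _ hz]
    exact coordField_pullField hs Y (e.map_source hz)
  have hXD : X ∈ D.vectorFields := by
    refine ⟨hχs, fun z => ?_⟩
    by_cases hz : z ∈ e.source
    · refine (D.space z).smul_mem _ ((he.mem_iff z hz _).2 ?_)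
      rw [hXY z hz]
    · simp only [hXdef, hχ0 z hz, zero_smul]
      exact (D.space z).zero_mem
  -- Near `x` the cut-off is `1`, so that `X` has the coordinate expression `(u, A u)` there.
  have hcX : coordField e X =ᶠ[𝓝 (e x)] Y := by
    have h1 : Tendsto e.symm (𝓝 (e x)) (𝓝 x) := e.tendsto_symm hx
    filter_upwards [h1 hχ1, e.open_target.mem_nhds (e.map_source hx)] with y hy hyt
    have h2 : χ (e.symm y) = 1 := hy
    have h3 := coordField_pullField (d := m + n) hs Y hyt
    rw [← h3]
    simp only [coordField, hXdef, h2, one_smul]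
    rfl
  obtain ⟨ε, W, Φ, hΦ, hxW, -⟩ := exists_isLocalFlow (hD hXD).1 hs isOpen_univ hx (mem_univ x)
  have h0 : (0 : ℝ) ∈ Ioo (-ε) ε := ⟨by linarith [hΦ.pos], hΦ.pos⟩
  have hΦ0 : fderiv ℝ (Φ 0) (e x) = ContinuousLinearMap.id ℝ _ := by
    have h1 : Φ 0 =ᶠ[𝓝 (e x)] id := by
      have h2 : e '' W ∈ 𝓝 (e x) :=
        (e.isOpen_image_of_subset_source hΦ.isOpen hΦ.subset_source).mem_nhds
          (mem_image_of_mem e hxW)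
      filter_upwards [h2]
      rintro _ ⟨z, hz, rfl⟩
      exact hΦ.zero z hz
    rw [h1.fderiv_eq, fderiv_id]
  -- `V` is the image of `(v, A v)` under the flow; the claim is the derivative at `t = 0` of the
  -- identity `(V t).2 = A (Φ t (e x)) (V t).1`.
  set V := fun t => fderiv ℝ (Φ t) (e x) (v, A (e x) v) with hV
  have hV0 : V 0 = (v, A (e x) v) := by
    simp [hV, hΦ0]
  have hAd : HasFDerivAt A (fderiv ℝ A (e x)) (e x) :=
    ((he.contDiffOn.contDiffAt (e.open_target.mem_nhds (e.map_source hx))).differentiableAt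
      (by simp)).hasFDerivAt
  have hYd : HasFDerivAt Y _ (e x) := (hasFDerivAt_const u (e x)).prodMk
    (hAd.clm_apply (hasFDerivAt_const u (e x)))
  have hVd : HasDerivAt V (0, fderiv ℝ A (e x) (v, A (e x) v) u) 0 := by
    have h1 := hΦ.hasDerivAt_fderiv x hxW 0 h0 (v, A (e x) v)
    rw [hΦ.zero x hxW, hΦ0, hcX.fderiv_eq, hYd.fderiv] at h1
    convert! h1 using 1
    simp
  have hγd : HasDerivAt (fun t => Φ t (e x)) (u, A (e x) u) 0 := by
    have h1 := hΦ.hasDerivAt x hxW 0 h0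
    rw [hΦ.zero x hxW, hcX.self_of_nhds] at h1
    exact h1
  have htan : ∀ t ∈ Ioo (-ε) ε, (V t).2 = A (Φ t (e x)) (V t).1 := by
    intro t ht
    set w : TangentSpace (𝓡 (m + n)) x := pullField e (fun y => (v, A y v)) x with hw
    have hw1 : mfderiv (𝓡 (m + n)) 𝓘(ℝ, EuclideanSpace ℝ (Fin m) × EuclideanSpace ℝ (Fin n)) e x w =
        (v, A (e x) v) := by
      rw [← coordField_apply (pullField e (fun y => (v, A y v))) hx]
      exact coordField_pullField hs _ (e.map_source hx)
    have hwD : w ∈ D.space x := (he.mem_iff x hx w).2 (by rw [hw1])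
    have h1 := (hD hXD).2 t x (hΦ.mem_flowDomain x hxW t ht)
    have h2 : mfderiv (𝓡 (m + n)) (𝓡 (m + n)) (flowMap X t) x w ∈ D.space (flowMap X t x) := by
      rw [← h1]
      exact Submodule.mem_map_of_mem hwD
    have h3 : flowMap X t x ∈ e.source := by
      rw [hΦ.flowMap_eq x hxW t ht]
      exact e.map_target (hΦ.mem_target x hxW t ht)
    have h4 := (he.mem_iff _ h3 _).1 h2
    rw [hΦ.mfderiv_flowMap hs hxW ht, hw1, hΦ.flowMap_eq x hxW t ht,
      e.right_inv (hΦ.mem_target x hxW t ht)] at h4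
    exact h4
  have hAγ : HasDerivAt (fun t => A (Φ t (e x))) (fderiv ℝ A (e x) (u, A (e x) u)) 0 := by
    have hAd' : HasFDerivAt A (fderiv ℝ A (e x)) (Φ 0 (e x)) := by
      rw [hΦ.zero x hxW]
      exact hAd
    exact hAd'.comp_hasDerivAt 0 hγd
  have h1 : HasDerivAt (fun t => (V t).2) (fderiv ℝ A (e x) (v, A (e x) v) u) 0 := hVd.snd
  have h2 : HasDerivAt (fun t => A (Φ t (e x)) (V t).1)
      (fderiv ℝ A (e x) (u, A (e x) u) v) 0 := by
    have h3 : HasDerivAt (fun t => (V t).1) 0 0 := hVd.fst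
    have h4 := hAγ.clm_apply h3
    rw [hV0] at h4
    simpa using h4
  have h3 : (fun t => (V t).2) =ᶠ[𝓝 0] fun t => A (Φ t (e x)) (V t).1 := by
    filter_upwards [isOpen_Ioo.mem_nhds h0] with t ht
    exact htan t ht
  exact (h2.congr_of_eventuallyEq h3).unique h1

/-- Near a point of a flat chart and for small times, the flow of a vector field in `D` is
differentiable and preserves `D`: its derivative does not change the second component, and it is
injective because the flow is invertible. -/
theorem IsFlatChart.exists_local_preserved {e : OpenPartialHomeomorph M
      (EuclideanSpace ℝ (Fin m) × EuclideanSpace ℝ (Fin n))} (he : IsFlatChart D e)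
    {X : (x : M) → TangentSpace (𝓡 (m + n)) x} (hX : X ∈ D.vectorFields) {p : M}
    (hp : p ∈ e.source) :
    ∃ ε > 0, ∃ W : Set M, IsOpen W ∧ p ∈ W ∧ ∀ x ∈ W, ∀ t ∈ Ioo (-ε) ε, x ∈ flowDomain X t ∧
      MDifferentiableAt (𝓡 (m + n)) (𝓡 (m + n)) (flowMap X t) x ∧
      (D.space x).map (mfderiv (𝓡 (m + n)) (𝓡 (m + n)) (flowMap X t) x).toLinearMap =
        D.space (flowMap X t x) := by
  have hs := he.isSmoothCoord
  obtain ⟨ε₁, W₁, Φ₁, h₁, hp₁, -⟩ := exists_isLocalFlow hX.1 hs isOpen_univ hp (mem_univ p)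
  -- The flow maps `W` into `W₁`, where the flow for the opposite time is differentiable as well.
  obtain ⟨ε, W, Φ, hΦ, hpW, hW₁⟩ := exists_isLocalFlow hX.1 hs h₁.isOpen hp hp₁
  refine ⟨min ε₁ ε, lt_min h₁.pos hΦ.pos, W, hΦ.isOpen, hpW, fun x hx t ht => ?_⟩
  have ht₁ : -t ∈ Ioo (-ε₁) ε₁ :=
    ⟨by linarith [ht.2, min_le_left ε₁ ε], by linarith [ht.1, min_le_left ε₁ ε]⟩
  have ht' : t ∈ Ioo (-ε) ε :=
    ⟨by linarith [ht.1, min_le_right ε₁ ε], by linarith [ht.2, min_le_right ε₁ ε]⟩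
  have hd := hΦ.mdifferentiableAt hs hx ht'
  refine ⟨hΦ.mem_flowDomain x hx t ht', hd, ?_⟩
  have hd₁ := h₁.mdifferentiableAt hs (hW₁ x hx t ht') ht₁
  have hid : flowMap X (-t) ∘ flowMap X t =ᶠ[𝓝 x] id := by
    filter_upwards [hΦ.isOpen.mem_nhds hx] with y hy
    exact (flowMap_neg hX.1 (hΦ.mem_flowDomain y hy t ht')).2
  have hcomp := (mfderiv_comp x hd₁ hd).symm.trans (hid.mfderiv_eq.trans mfderiv_id)
  have hinj : Function.Injective (mfderiv (𝓡 (m + n)) (𝓡 (m + n)) (flowMap X t) x) := by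
    intro v w hvw
    have h1 := congrArg (fun L : TangentSpace (𝓡 (m + n)) x →L[ℝ] TangentSpace (𝓡 (m + n)) x => L v)
      hcomp
    have h2 := congrArg (fun L : TangentSpace (𝓡 (m + n)) x →L[ℝ] TangentSpace (𝓡 (m + n)) x => L w)
      hcomp
    refine h1.symm.trans (Eq.trans ?_ h2)
    exact congrArg (mfderiv (𝓡 (m + n)) (𝓡 (m + n)) (flowMap X (-t)) (flowMap X t x)) hvw
  have hsnd : ∀ w, (fderiv ℝ (Φ t) (e x) w).2 = w.2 := by
    intro w
    have h1 : (fun y => (Φ t y).2) =ᶠ[𝓝 (e x)] Prod.snd := by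
      have h2 : e '' W ∈ 𝓝 (e x) :=
        (e.isOpen_image_of_subset_source hΦ.isOpen hΦ.subset_source).mem_nhds
          (mem_image_of_mem e hx)
      filter_upwards [h2]
      rintro _ ⟨z, hz, rfl⟩
      exact he.snd_flow hX hΦ hz ht'
    have h3 := ((hΦ.differentiableAt x hx t ht').hasFDerivAt.snd.congr_of_eventuallyEq
      h1.symm).unique hasFDerivAt_snd
    exact congrArg (fun L : EuclideanSpace ℝ (Fin m) × EuclideanSpace ℝ (Fin n) →L[ℝ]
      EuclideanSpace ℝ (Fin n) => L w) h3
  have hmem : flowMap X t x ∈ e.source := h₁.subset_source (hW₁ x hx t ht')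
  have : FiniteDimensional ℝ (TangentSpace (𝓡 (m + n)) (flowMap X t x)) :=
    inferInstanceAs (FiniteDimensional ℝ (EuclideanSpace ℝ (Fin (m + n))))
  refine Submodule.eq_of_le_of_finrank_eq ?_ ?_
  · rintro _ ⟨v, hv, rfl⟩
    refine (he.mem_iff _ hmem _).2 ?_
    have h1 := hΦ.mfderiv_flowMap hs hx ht' v
    refine (congrArg Prod.snd h1).trans ((hsnd _).trans ?_)
    exact (he.mem_iff x (hΦ.subset_source hx) v).1 hv
  · exact ((Submodule.equivMapOfInjective _ hinj _).finrank_eq.symm.trans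
      (D.finrank_space x)).trans (D.finrank_space _).symm

/-- If `D` has a flat chart at every point, then the flows of vector fields in `D` preserve `D`:
this holds for small times, and the set of times for which it holds along an integral curve is open
and closed. -/
theorem HasFlatCharts.vectorFields_subset_symmetries (hflat : HasFlatCharts D) :
    D.vectorFields ⊆ D.symmetries := by
  intro X hX
  refine ⟨hX.1, fun t x hxt => ?_⟩
  have hxt' := hxt
  obtain ⟨γ, hγ⟩ := hxt
  have hγ0 := hγ.1
  obtain ⟨-, a, b, h0ab, htab, hγc⟩ := hγ
  have hdom : ∀ s ∈ Ioo a b, IsIntegralCurveFromTo X x s γ := fun s hs =>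
    ⟨hγ0, a, b, h0ab, hs, hγc⟩
  have hval : ∀ s ∈ Ioo a b, flowMap X s x = γ s := fun s hs => flowMap_eq hX.1 (hdom s hs)
  let Q : ℝ → Prop := fun s => flowDomain X s ∈ 𝓝 x ∧
    MDifferentiableAt (𝓡 (m + n)) (𝓡 (m + n)) (flowMap X s) x ∧
      (D.space x).map (mfderiv (𝓡 (m + n)) (𝓡 (m + n)) (flowMap X s) x).toLinearMap =
        D.space (flowMap X s x)
  have hloc : ∀ p : M, ∃ ε > 0, ∃ W : Set M, IsOpen W ∧ p ∈ W ∧ ∀ x ∈ W, ∀ t ∈ Ioo (-ε) ε,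
      x ∈ flowDomain X t ∧ MDifferentiableAt (𝓡 (m + n)) (𝓡 (m + n)) (flowMap X t) x ∧
      (D.space x).map (mfderiv (𝓡 (m + n)) (𝓡 (m + n)) (flowMap X t) x).toLinearMap =
        D.space (flowMap X t x) := fun p => by
    obtain ⟨e, he, hp⟩ := hflat p
    exact he.exists_local_preserved hX hp
  have hQ0 : Q 0 := by
    obtain ⟨ε, hε, W, hW, hxW, h⟩ := hloc x
    have h0 : (0 : ℝ) ∈ Ioo (-ε) ε := ⟨by linarith, hε⟩
    exact ⟨mem_of_superset (hW.mem_nhds hxW) fun y hy => (h y hy 0 h0).1, (h x hxW 0 h0).2⟩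
  -- The condition propagates from one time to another one close to it, in both directions.
  have hstep : ∀ s₀ ∈ Ioo a b, ∀ᶠ s in 𝓝[Ioo a b] s₀, (Q s₀ → Q s) ∧ (Q s → Q s₀) := by
    intro s₀ hs₀
    obtain ⟨ε, hε, W, hW, hxW, h⟩ := hloc (γ s₀)
    have key : ∀ s ∈ Ioo a b, ∀ s' ∈ Ioo a b, γ s ∈ W → s' - s ∈ Ioo (-ε) ε → Q s → Q s' := by
      intro s hs s' hs' hsW hss' hQs
      rw [← hval s hs] at hsW
      obtain ⟨hQ1, hQ2, hQ3⟩ := hQs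
      have hev : ∀ᶠ y in 𝓝 x, y ∈ flowDomain X s ∧ flowMap X s y ∈ W :=
        Filter.Eventually.and hQ1 (hQ2.continuousAt.eventually (hW.mem_nhds hsW))
      have hadd : ∀ y, y ∈ flowDomain X s ∧ flowMap X s y ∈ W →
          y ∈ flowDomain X s' ∧ flowMap X s' y = flowMap X (s' - s) (flowMap X s y) := by
        rintro y ⟨hy1, hy2⟩
        have := flowMap_add hX.1 hy1 (h _ hy2 _ hss').1
        rwa [add_sub_cancel] at this
      have heq : flowMap X s' =ᶠ[𝓝 x] flowMap X (s' - s) ∘ flowMap X s :=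
        hev.mono fun y hy => (hadd y hy).2
      have hd := (h _ hsW _ hss').2.1
      refine ⟨hev.mono fun y hy => (hadd y hy).1, (hd.comp x hQ2).congr_of_eventuallyEq heq, ?_⟩
      have h1 : (D.space x).map (mfderiv (𝓡 (m + n)) (𝓡 (m + n)) (flowMap X s') x).toLinearMap =
          ((D.space x).map (mfderiv (𝓡 (m + n)) (𝓡 (m + n)) (flowMap X s) x).toLinearMap).map
            (mfderiv (𝓡 (m + n)) (𝓡 (m + n)) (flowMap X (s' - s)) (flowMap X s x)).toLinearMap := by
        have h2 := heq.mfderiv_eq.trans (mfderiv_comp x hd hQ2)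
        refine Eq.trans ?_ (Submodule.map_comp _ _ _)
        exact congrArg (fun L : TangentSpace (𝓡 (m + n)) x →L[ℝ] EuclideanSpace ℝ (Fin (m + n)) =>
          (D.space x).map L.toLinearMap) h2
      rw [(hadd x hev.self_of_nhds).2]
      refine h1.trans ?_
      rw [hQ3]
      exact (h _ hsW _ hss').2.2
    have hγW : ∀ᶠ s in 𝓝[Ioo a b] s₀, γ s ∈ W :=
      (hγc.continuousOn s₀ hs₀).eventually (hW.mem_nhds hxW)
    have hnear : ∀ᶠ s in 𝓝[Ioo a b] s₀, s ∈ Ioo (s₀ - ε) (s₀ + ε) :=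
      eventually_nhdsWithin_of_eventually_nhds
        (isOpen_Ioo.mem_nhds ⟨by linarith, by linarith⟩)
    filter_upwards [hγW, hnear, self_mem_nhdsWithin] with s hsW hs hsab
    exact ⟨key s₀ hs₀ s hsab hxW ⟨by linarith [hs.1], by linarith [hs.2]⟩,
      key s hsab s₀ hs₀ hsW ⟨by linarith [hs.2], by linarith [hs.1]⟩⟩
  have hQt : Q 0 → Q t := isPreconnected_Ioo.induction₂' (fun s s' => Q s → Q s') hstep
    (fun _ _ _ _ _ _ h1 h2 h => h2 (h1 h)) h0ab htab
  exact (hQt hQ0).2.2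

end Preservation

/-! ### Immersions and the construction of integral manifolds -/

/-- The restriction to an open subset of a chart in the maximal atlas is in the maximal atlas. -/
theorem StructureGroupoid.mem_maximalAtlas_subtypeRestr {H N : Type*} [TopologicalSpace H]
    [TopologicalSpace N] [ChartedSpace H N] (G : StructureGroupoid H) [HasGroupoid N G]
    [ClosedUnderRestriction G] {e : OpenPartialHomeomorph N H} (he : e ∈ G.maximalAtlas N)
    {s : TopologicalSpace.Opens N} (hs : Nonempty s) : e.subtypeRestr hs ∈ G.maximalAtlas s := by
  intro e' he'
  obtain ⟨x, rfl⟩ := TopologicalSpace.Opens.chart_eq hs he'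
  have hx := G.chart_mem_maximalAtlas (x : N)
  exact ⟨G.mem_of_eqOnSource (closedUnderRestriction' (G.compatible_of_mem_maximalAtlas he hx)
      (e.isOpen_inter_preimage_symm s.2)) (e.subtypeRestr_symm_trans_subtypeRestr hs _),
    G.mem_of_eqOnSource (closedUnderRestriction' (G.compatible_of_mem_maximalAtlas hx he)
      ((chartAt H (x : N)).isOpen_inter_preimage_symm s.2))
      ((chartAt H (x : N)).subtypeRestr_symm_trans_subtypeRestr hs _)⟩

section Immersion

variable {k d : ℕ} {N : Type u} [TopologicalSpace N] [ChartedSpace (EuclideanSpace ℝ (Fin k)) N]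
  {M : Type u} [TopologicalSpace M] [ChartedSpace (EuclideanSpace ℝ (Fin d)) M]
  {f : N → M}

theorem IsSmoothCoord.mem_maximalAtlas [IsManifold (𝓡 d) ∞ M]
    {e : OpenPartialHomeomorph M (EuclideanSpace ℝ (Fin d))} (he : IsSmoothCoord d e) :
    e ∈ IsManifold.maximalAtlas (𝓡 d) ∞ M :=
  e.mem_maximalAtlas_of_contMDiffOn he.contMDiffOn he.contMDiffOn_symm

/-- A map which in suitable smooth coordinates is `v ↦ (v, c)` is an immersion. -/
theorem isImmersion_of_isSmoothCoord [IsManifold (𝓡 k) ∞ N] [IsManifold (𝓡 d) ∞ M] {l : ℕ}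
    (hd : k + l = d)
    (h : ∀ p, ∃ (φ : OpenPartialHomeomorph N (EuclideanSpace ℝ (Fin k)))
      (e : OpenPartialHomeomorph M (EuclideanSpace ℝ (Fin k) × EuclideanSpace ℝ (Fin l)))
      (c : EuclideanSpace ℝ (Fin l)), IsSmoothCoord k φ ∧ IsSmoothCoord d e ∧ p ∈ φ.source ∧
        ∀ q ∈ φ.source, f q ∈ e.source ∧ e (f q) = (φ q, c)) :
    Manifold.IsImmersion (𝓡 k) (𝓡 d) ∞ f := by
  let L : (EuclideanSpace ℝ (Fin k) × EuclideanSpace ℝ (Fin l)) ≃L[ℝ] EuclideanSpace ℝ (Fin d) :=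
    ContinuousLinearEquiv.ofFinrankEq (by simp [hd])
  refine ⟨EuclideanSpace ℝ (Fin l), inferInstance, inferInstance, fun p => ?_⟩
  obtain ⟨φ, e, c, hφ, he, hp, hq⟩ := h p
  -- Translate by `(0, c)`, so that the immersion becomes `v ↦ (v, 0)`.
  let τ : (EuclideanSpace ℝ (Fin k) × EuclideanSpace ℝ (Fin l)) ≃ₜ EuclideanSpace ℝ (Fin d) :=
    (Homeomorph.addRight (0, -c)).trans L.toHomeomorph
  have hτ : ContDiff ℝ ∞ τ := L.contDiff.comp (contDiff_id.add contDiff_const)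
  have hτ' : ContDiff ℝ ∞ τ.symm := L.symm.contDiff.add contDiff_const
  have he' : IsSmoothCoord d (e.trans τ.toOpenPartialHomeomorph) :=
    he.trans hτ.contDiffOn hτ'.contDiffOn
  refine Manifold.IsImmersionAtOfComplement.mk_of_charts L φ (e.trans τ.toOpenPartialHomeomorph)
    hp ?_ hφ.mem_maximalAtlas he'.mem_maximalAtlas ?_ ?_
  · simpa using (hq p hp).1
  · intro q hqs
    simpa using (hq q hqs).1
  · intro v hv
    have hv' : v ∈ φ.target := by simpa using hv
    have h1 := (hq _ (φ.map_target hv')).2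
    rw [φ.right_inv hv'] at h1
    simp [h1, τ]

/-- An immersion has a local left inverse, which in the adapted charts is a linear projection. -/
theorem mfderiv_injective_of_isImmersion [IsManifold (𝓡 k) ∞ N] [IsManifold (𝓡 d) ∞ M]
    (h : Manifold.IsImmersion (𝓡 k) (𝓡 d) ∞ f) (p : N) :
    Function.Injective (mfderiv (𝓡 k) (𝓡 d) f p) := by
  have h' := h.isImmersionAt p
  set φ := h'.domChart
  set ψ := h'.codChart
  have hφ := h'.domChart_mem_maximalAtlas
  have hψ := h'.codChart_mem_maximalAtlas
  have hp : p ∈ φ.source := h'.mem_domChart_source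
  have hψp : f p ∈ ψ.source := h'.mem_codChart_source
  let π : EuclideanSpace ℝ (Fin d) →L[ℝ] EuclideanSpace ℝ (Fin k) :=
    (ContinuousLinearMap.fst ℝ _ _).comp h'.equiv.symm.toContinuousLinearMap
  have hπ : ∀ q ∈ φ.source, π (ψ (f q)) = φ q := by
    intro q hq
    have hq' : φ q ∈ (φ.extend (𝓡 k)).target := by simpa using φ.map_source hq
    have h1 := h'.writtenInCharts hq'
    have h2 : ψ (f q) = h'.equiv (φ q, 0) := by
      have h3 : ψ (f (φ.symm (φ q))) = h'.equiv (φ q, 0) := by simpa using h1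
      rwa [φ.left_inv hq] at h3
    simp [π, h2]
  have hfp : MDifferentiableAt (𝓡 k) (𝓡 d) f p := (h.contMDiff p).mdifferentiableAt (by simp)
  have hψd : MDifferentiableAt (𝓡 d) (𝓡 d) ψ (f p) :=
    ((contMDiffOn_of_mem_maximalAtlas hψ).contMDiffAt
      (ψ.open_source.mem_nhds hψp)).mdifferentiableAt (by simp)
  have hπd : MDifferentiableAt (𝓡 d) (𝓡 k) π (ψ (f p)) := π.mdifferentiableAt
  have hcomp : MDifferentiableAt (𝓡 d) (𝓡 k) (π ∘ ψ) (f p) := hπd.comp _ hψd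
  have hφi : Function.Injective (mfderiv (𝓡 k) (𝓡 k) φ p) :=
    (IsSmoothCoord.mfderiv_injective (F := EuclideanSpace ℝ (Fin k))
      ⟨contMDiffOn_of_mem_maximalAtlas hφ, contMDiffOn_symm_of_mem_maximalAtlas hφ⟩ hp)
  have heq : (π ∘ ψ) ∘ f =ᶠ[𝓝 p] φ := by
    filter_upwards [φ.open_source.mem_nhds hp] with q hq using hπ q hq
  have h3 := (mfderiv_comp p hcomp hfp).symm.trans heq.mfderiv_eq
  intro v w hvw
  apply hφi
  have h4 := congrArg (fun L : TangentSpace (𝓡 k) p →L[ℝ] EuclideanSpace ℝ (Fin k) => L v) h3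
  have h5 := congrArg (fun L : TangentSpace (𝓡 k) p →L[ℝ] EuclideanSpace ℝ (Fin k) => L w) h3
  refine h4.symm.trans (Eq.trans ?_ h5)
  exact congrArg (mfderiv (𝓡 d) (𝓡 k) (π ∘ ψ) (f p)) hvw

/-- The restriction of an immersion to an open subset is an immersion. -/
theorem isImmersion_comp_subtype_val [IsManifold (𝓡 k) ∞ N]
    (h : Manifold.IsImmersion (𝓡 k) (𝓡 d) ∞ f) (s : TopologicalSpace.Opens N) :
    Manifold.IsImmersion (𝓡 k) (𝓡 d) ∞ (f ∘ (Subtype.val : s → N)) := by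
  refine ⟨h.complement, inferInstance, inferInstance, fun p => ?_⟩
  have h' := h.isImmersionOfComplement_complement p.1
  refine Manifold.IsImmersionAtOfComplement.mk_of_charts h'.equiv (h'.domChart.subtypeRestr ⟨p⟩)
    h'.codChart ?_ h'.mem_codChart_source ?_ h'.codChart_mem_maximalAtlas ?_ ?_
  · simpa [OpenPartialHomeomorph.subtypeRestr_source] using h'.mem_domChart_source
  · exact (contDiffGroupoid ∞ (𝓡 k)).mem_maximalAtlas_subtypeRestr
      h'.domChart_mem_maximalAtlas ⟨p⟩
  · intro q hq
    exact h'.source_subset_preimage_source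
      (by simpa [OpenPartialHomeomorph.subtypeRestr_source] using hq)
  · intro v hv
    have hv' : v ∈ (h'.domChart.subtypeRestr ⟨p⟩).target := by simpa using hv
    have h1 := h'.domChart.subtypeRestr_symm_eqOn ⟨p⟩ hv'
    have hv'' : v ∈ (h'.domChart.extend (𝓡 k)).target := by
      simpa using h'.domChart.subtypeRestr_target_subset ⟨p⟩ hv'
    have h2 := h'.writtenInCharts hv''
    refine Eq.trans ?_ h2
    exact congrArg (fun q => h'.codChart (f q)) h1.symm

end Immersion

section IntegralManifold

variable {m n : ℕ} {M : Type u} [TopologicalSpace M]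
  [ChartedSpace (EuclideanSpace ℝ (Fin (m + n))) M] [IsManifold (𝓡 (m + n)) ∞ M]
  {D : TangentDistribution m n M} {k : ℕ}

namespace TangentDistribution

attribute [instance] IntegralManifold.top IntegralManifold.charted IntegralManifold.isManifold
  IntegralManifold.secondCountable

/-- The integral manifold given by an open subset of a manifold which is injectively immersed in
`M` and tangent to `D`. The ambient manifold is not required to be second countable. -/
def IntegralManifold.ofOpens (D : TangentDistribution m n M) {k : ℕ} {N : Type u}
    [TopologicalSpace N] [ChartedSpace (EuclideanSpace ℝ (Fin k)) N] [IsManifold (𝓡 k) ∞ N]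
    {f : N → M} (hf : Function.Injective f) (him : Manifold.IsImmersion (𝓡 k) (𝓡 (m + n)) ∞ f)
    (htan : ∀ p, (mfderiv (𝓡 k) (𝓡 (m + n)) f p).range ≤ D.space (f p))
    (s : TopologicalSpace.Opens N) [SecondCountableTopology s] [Nonempty s] :
    D.IntegralManifold k where
  carrier := s
  f := f ∘ Subtype.val
  injective := hf.comp Subtype.val_injective
  immersion := isImmersion_comp_subtype_val him s
  tangent := fun p => by
    rintro _ ⟨v, rfl⟩
    have h1 : MDifferentiableAt (𝓡 k) (𝓡 (m + n)) f p.1 :=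
      (him.contMDiff p.1).mdifferentiableAt (by simp)
    have h2 : MDifferentiableAt (𝓡 k) (𝓡 k) (Subtype.val : s → N) p :=
      (contMDiff_subtype_val (n := 1) p).mdifferentiableAt (by simp)
    have h3 := mfderiv_comp p h1 h2
    have h4 := congrArg (fun L : TangentSpace (𝓡 k) p →L[ℝ] TangentSpace (𝓡 (m + n)) (f p.1) =>
      L v) h3
    exact (congrArg (fun w => w ∈ D.space (f p.1)) h4).mpr (htan p.1 ⟨_, rfl⟩)

/-- A point is an integral manifold of dimension zero. -/
theorem exists_integralManifold_zero (D : TangentDistribution m n M) (x : M) :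
    ∃ N : D.IntegralManifold 0, N.toSet = {x} := by
  let _ : ChartedSpace (EuclideanSpace ℝ (Fin 0)) PUnit.{u + 1} := ChartedSpace.ofDiscreteTopology
  have : IsManifold (𝓡 0) ∞ PUnit.{u + 1} := IsManifold.of_discreteTopology _
  let f : PUnit.{u + 1} → M := fun _ => x
  have him : Manifold.IsImmersion (𝓡 0) (𝓡 (m + n)) ∞ f := by
    refine isImmersion_of_isSmoothCoord (l := m + n) (zero_add _) fun p => ?_
    let L : EuclideanSpace ℝ (Fin (m + n)) ≃L[ℝ]
        EuclideanSpace ℝ (Fin 0) × EuclideanSpace ℝ (Fin (m + n)) :=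
      (ContinuousLinearEquiv.uniqueProd ℝ _ _).symm
    let e := chartAt (EuclideanSpace ℝ (Fin (m + n))) x
    refine ⟨chartAt _ p, e.trans L.toHomeomorph.toOpenPartialHomeomorph, e x,
      IsSmoothCoord.of_chartAt p,
      (IsSmoothCoord.of_chartAt x).trans L.contDiff.contDiffOn L.symm.contDiff.contDiffOn,
      mem_chart_source _ p, fun q _ => ⟨by simp [e, f], ?_⟩⟩
    exact Prod.ext (Subsingleton.elim _ _) rfl
  refine ⟨⟨PUnit.{u + 1}, f, fun _ _ _ => rfl, him, ?_⟩, ?_⟩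
  · rintro p _ ⟨v, rfl⟩
    have : v = 0 := Subsingleton.elim (α := EuclideanSpace ℝ (Fin 0)) _ _
    rw [this, map_zero]
    exact (D.space _).zero_mem
  · exact range_const

theorem IntegralManifold.dim_le (N : D.IntegralManifold k) : k ≤ m := by
  obtain ⟨p⟩ := N.nonempty
  have h1 := mfderiv_injective_of_isImmersion N.immersion p
  have : FiniteDimensional ℝ (TangentSpace (𝓡 (m + n)) (N.f p)) :=
    inferInstanceAs (FiniteDimensional ℝ (EuclideanSpace ℝ (Fin (m + n))))
  have h2 := Submodule.finrank_mono (N.tangent p)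
  rw [D.finrank_space] at h2
  refine le_trans (le_of_eq ?_) h2
  exact ((LinearMap.finrank_range_of_inj h1).trans finrank_euclideanSpace_fin).symm

/-- The part of an integral manifold in an open set is an integral manifold. -/
theorem IntegralManifold.exists_restrict (N : D.IntegralManifold k) {W : Set M} (hW : IsOpen W)
    (h : (N.toSet ∩ W).Nonempty) : ∃ N' : D.IntegralManifold k, N'.toSet = N.toSet ∩ W := by
  let s : TopologicalSpace.Opens N.carrier :=
    ⟨N.f ⁻¹' W, hW.preimage N.immersion.contMDiff.continuous⟩
  have : Nonempty s := by
    obtain ⟨_, ⟨p, rfl⟩, hp⟩ := h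
    exact ⟨⟨p, hp⟩⟩
  refine ⟨.ofOpens D N.injective N.immersion N.tangent s, ?_⟩
  ext x
  constructor
  · rintro ⟨p, rfl⟩
    exact ⟨⟨p.1, rfl⟩, p.2⟩
  · rintro ⟨⟨p, rfl⟩, hp⟩
    exact ⟨⟨p, hp⟩, rfl⟩

/-- If `D` is completely integrable, then the integral manifolds of maximal dimension are dense:
in a given open set an integral manifold of the largest possible dimension is maximal. -/
theorem IsCompletelyIntegrable.exists_integralManifold (hD : D.IsCompletelyIntegrable)
    {W : Set M} (hW : IsOpen W) (hne : W.Nonempty) :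
    ∃ N : D.IntegralManifold m, (N.toSet ∩ W).Nonempty := by
  classical
  let P : ℕ → Prop := fun k => ∃ N : D.IntegralManifold k, (N.toSet ∩ W).Nonempty
  have hP0 : P 0 := by
    obtain ⟨x, hx⟩ := hne
    obtain ⟨N, hN⟩ := D.exists_integralManifold_zero x
    exact ⟨N, x, by simp [hN], hx⟩
  -- Dimensions of integral manifolds are bounded by `m`, so there is a largest one.
  have hk := Nat.findGreatest_spec (P := P) (Nat.zero_le m) hP0
  have hmax : ∀ l, P l → l ≤ Nat.findGreatest P m := fun l hl =>
    Nat.le_findGreatest hl.choose.dim_le hl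
  generalize Nat.findGreatest P m = k at hk hmax
  obtain ⟨N, hN⟩ := hk
  obtain ⟨N', hN'⟩ := N.exists_restrict hW hN
  have hmaxN : N'.IsMaximal := by
    refine fun x hx => ⟨univ, isOpen_univ, mem_univ x, ?_⟩
    rintro ⟨l, N'', hl, hsub⟩
    have hx' : x ∈ N.toSet ∩ W := hN' ▸ hx
    exact hl.not_ge (hmax l ⟨N'', x, hsub ⟨hx, mem_univ x⟩, hx'.2⟩)
  obtain rfl := hD k N' hmaxN
  exact ⟨N, hN⟩

end TangentDistribution

end IntegralManifold

/-! ### Complete integrability implies involutivity -/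

/-- The graph distribution of `A` is involutive at the points of its integral submanifolds of
maximal dimension: the derivative of the tangency condition contains the symmetric second
derivative of the parametrization `g`. -/
theorem isInvolutiveAt_of_tangent {E G : Type} [NormedAddCommGroup E] [NormedSpace ℝ E]
    [FiniteDimensional ℝ E] [NormedAddCommGroup G] [NormedSpace ℝ G] {A : E × G → E →L[ℝ] G}
    {g : E → E × G} {x : E} (hg : ContDiffAt ℝ ∞ g x) (hA : DifferentiableAt ℝ A (g x))
    (htan : ∀ᶠ y in 𝓝 x, ∀ ξ, (fderiv ℝ g y ξ).2 = A (g y) (fderiv ℝ g y ξ).1)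
    (hinj : Function.Injective (fderiv ℝ g x)) : IsInvolutiveAt A (g x) := by
  intro u v
  have hP : Function.Surjective ((LinearMap.fst ℝ E G).comp (fderiv ℝ g x).toLinearMap) := by
    refine LinearMap.surjective_of_injective fun ξ η h => hinj ?_
    have h' : (fderiv ℝ g x ξ).1 = (fderiv ℝ g x η).1 := h
    refine Prod.ext h' ?_
    rw [htan.self_of_nhds, htan.self_of_nhds, h']
  obtain ⟨ξ, hξ⟩ := hP u
  obtain ⟨η, hη⟩ := hP v
  have hξ' : fderiv ℝ g x ξ = (u, A (g x) u) :=
    Prod.ext hξ ((htan.self_of_nhds ξ).trans (congrArg _ hξ))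
  have hη' : fderiv ℝ g x η = (v, A (g x) v) :=
    Prod.ext hη ((htan.self_of_nhds η).trans (congrArg _ hη))
  have hg2 : DifferentiableAt ℝ (fderiv ℝ g) x :=
    (hg.fderiv_right (m := 1) (by norm_cast)).differentiableAt (by simp)
  have hg1 : HasFDerivAt g (fderiv ℝ g x) x := (hg.differentiableAt (by simp)).hasFDerivAt
  have hsymm : IsSymmSndFDerivAt ℝ g x := hg.isSymmSndFDerivAt (by
    rw [minSmoothness_of_isRCLikeNormedField]
    exact WithTop.coe_le_coe.2 le_top)
  -- The derivative of the tangency condition for `ξ` in the direction `η`.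
  have key : ∀ ξ η : E, (fderiv ℝ (fderiv ℝ g) x η ξ).2 =
      fderiv ℝ A (g x) (fderiv ℝ g x η) (fderiv ℝ g x ξ).1 +
        A (g x) (fderiv ℝ (fderiv ℝ g) x η ξ).1 := by
    intro ξ η
    have h1 : HasFDerivAt (fun y => fderiv ℝ g y ξ) ((fderiv ℝ (fderiv ℝ g) x).flip ξ) x := by
      simpa using hg2.hasFDerivAt.clm_apply (hasFDerivAt_const ξ x)
    have h2 : HasFDerivAt (fun y => A (g y)) ((fderiv ℝ A (g x)).comp (fderiv ℝ g x)) x :=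
      hA.hasFDerivAt.comp x hg1
    have h3 := h2.clm_apply h1.fst
    have h4 := (h3.congr_of_eventuallyEq (htan.mono fun y hy => hy ξ)).unique h1.snd
    have h5 := congrArg (fun L : E →L[ℝ] G => L η) h4
    simp at h5
    rw [← h5, add_comm]
  have h1 := key ξ η
  have h2 := key η ξ
  rw [hsymm.eq η ξ, hξ', hη'] at h1
  rw [hξ', hη'] at h2
  exact add_right_cancel (h2.symm.trans h1)

section

variable {m n : ℕ} {M : Type u} [TopologicalSpace M]
  [ChartedSpace (EuclideanSpace ℝ (Fin (m + n))) M] [IsManifold (𝓡 (m + n)) ∞ M]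
  {D : TangentDistribution m n M}

theorem IsGraphChart.isInvolutiveAt_of_integralManifold
    {e : OpenPartialHomeomorph M (EuclideanSpace ℝ (Fin m) × EuclideanSpace ℝ (Fin n))}
    {A : EuclideanSpace ℝ (Fin m) × EuclideanSpace ℝ (Fin n) →
      EuclideanSpace ℝ (Fin m) →L[ℝ] EuclideanSpace ℝ (Fin n)} (he : IsGraphChart D e A)
    (N : D.IntegralManifold m) (p : N.carrier) (hp : N.f p ∈ e.source) :
    IsInvolutiveAt A (e (N.f p)) := by
  set φ := chartAt (EuclideanSpace ℝ (Fin m)) p with hφ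
  have hpφ : p ∈ φ.source := mem_chart_source _ p
  have hφs : IsSmoothCoord m φ := IsSmoothCoord.of_chartAt p
  have hs := he.isSmoothCoord
  have hf := N.immersion.contMDiff
  set O : Set (EuclideanSpace ℝ (Fin m)) := φ.target ∩ φ.symm ⁻¹' (N.f ⁻¹' e.source) with hO
  have hOo : IsOpen O := φ.isOpen_inter_preimage_symm (e.open_source.preimage hf.continuous)
  have hpO : φ p ∈ O := ⟨φ.map_source hpφ, by simpa [φ.left_inv hpφ] using hp⟩
  let g : EuclideanSpace ℝ (Fin m) → EuclideanSpace ℝ (Fin m) × EuclideanSpace ℝ (Fin n) :=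
    fun v => e (N.f (φ.symm v))
  have hg : ContDiffOn ℝ ∞ g O := by
    rw [← contMDiffOn_iff_contDiffOn]
    exact hs.contMDiffOn.comp (hf.comp_contMDiffOn
      (hφs.contMDiffOn_symm.mono inter_subset_left)) fun v hv => hv.2
  have hder : ∀ v ∈ O, ∀ ξ : EuclideanSpace ℝ (Fin m), fderiv ℝ g v ξ =
      mfderiv (𝓡 (m + n)) 𝓘(ℝ, EuclideanSpace ℝ (Fin m) × EuclideanSpace ℝ (Fin n)) e
        (N.f (φ.symm v)) (mfderiv (𝓡 m) (𝓡 (m + n)) N.f (φ.symm v)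
          (mfderiv (𝓡 m) (𝓡 m) φ.symm v ξ)) := by
    intro v hv ξ
    have h1 : HasMFDerivAt (𝓡 m) (𝓡 m) φ.symm v _ :=
      (hφs.mdifferentiableAt_symm hv.1).hasMFDerivAt
    have h2 : HasMFDerivAt (𝓡 m) (𝓡 (m + n)) N.f (φ.symm v) _ :=
      ((hf _).mdifferentiableAt (by simp)).hasMFDerivAt
    have h3 := (hs.mdifferentiableAt hv.2).hasMFDerivAt
    have h4 := (h3.comp v (h2.comp v h1)).mfderiv
    rw [← mfderiv_eq_fderiv]
    exact congrArg (fun L : EuclideanSpace ℝ (Fin m) →L[ℝ]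
      EuclideanSpace ℝ (Fin m) × EuclideanSpace ℝ (Fin n) => L ξ) h4
  have hgp : g (φ p) = e (N.f p) := by simp [g, φ.left_inv hpφ]
  rw [← hgp]
  refine isInvolutiveAt_of_tangent (hg.contDiffAt (hOo.mem_nhds hpO)) ?_ ?_ ?_
  · rw [hgp]
    exact (he.contDiffOn.contDiffAt (e.open_target.mem_nhds (e.map_source hp))).differentiableAt
      (by simp)
  · filter_upwards [hOo.mem_nhds hpO] with v hv ξ
    rw [hder v hv]
    exact (he.mem_iff _ hv.2 _).1 (N.tangent _ ⟨_, rfl⟩)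
  · intro ξ η h
    rw [hder _ hpO, hder _ hpO] at h
    have h1 := mfderiv_injective_of_isImmersion N.immersion _ (hs.mfderiv_injective hpO.2 h)
    have h2 := hφs.mdifferentiable.symm.mfderiv_injective hpO.1
    exact h2 h1

/-- Involutivity is a closed condition, so that it follows from the existence of a dense set of
integral manifolds. -/
theorem IsGraphChart.isInvolutiveAt_of_isCompletelyIntegrable (hD : D.IsCompletelyIntegrable)
    {e : OpenPartialHomeomorph M (EuclideanSpace ℝ (Fin m) × EuclideanSpace ℝ (Fin n))}
    {A : EuclideanSpace ℝ (Fin m) × EuclideanSpace ℝ (Fin n) →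
      EuclideanSpace ℝ (Fin m) →L[ℝ] EuclideanSpace ℝ (Fin n)} (he : IsGraphChart D e A)
    {x : M} (hx : x ∈ e.source) : IsInvolutiveAt A (e x) := by
  intro u v
  by_contra hne
  have hA' : ContinuousOn (fderiv ℝ A) e.target :=
    he.contDiffOn.continuousOn_fderiv_of_isOpen e.open_target (by simp)
  have hA : ContinuousOn A e.target := he.contDiffOn.continuousOn
  have hc : ∀ u v : EuclideanSpace ℝ (Fin m),
      ContinuousOn (fun y => fderiv ℝ A y (u, A y u) v) e.target := fun u v =>
    (hA'.clm_apply (continuousOn_const.prodMk (hA.clm_apply continuousOn_const))).clm_apply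
      continuousOn_const
  have hopen : IsOpen (e.source ∩ e ⁻¹' (e.target ∩
      {y | fderiv ℝ A y (u, A y u) v - fderiv ℝ A y (v, A y v) u ≠ 0})) :=
    e.isOpen_inter_preimage
      (((hc u v).sub (hc v u)).isOpen_inter_preimage e.open_target isOpen_ne)
  obtain ⟨N, _, ⟨p, rfl⟩, hp, -, hp'⟩ := hD.exists_integralManifold hopen
    ⟨x, hx, e.map_source hx, sub_ne_zero.2 hne⟩
  exact hp' (sub_eq_zero.2 (he.isInvolutiveAt_of_integralManifold N p hp u v))

theorem hasFlatCharts_of_isCompletelyIntegrable (hD : D.IsCompletelyIntegrable) :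
    HasFlatCharts D := by
  intro p
  obtain ⟨e, A, he, hp⟩ := exists_isGraphChart D p
  exact he.exists_isFlatChart (fun x hx => he.isInvolutiveAt_of_isCompletelyIntegrable hD hx) hp

end

/-! ### The leaf space of a distribution with flat charts -/

section Plaque

variable {m n : ℕ} {M : Type u} [TopologicalSpace M]

/-- The plaque at height `c` of the chart `e`, with the first component of `e` as coordinate. -/
def plaqueChart (e : OpenPartialHomeomorph M (EuclideanSpace ℝ (Fin m) × EuclideanSpace ℝ (Fin n)))
    (c : EuclideanSpace ℝ (Fin n)) : PartialEquiv M (EuclideanSpace ℝ (Fin m)) where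
  toFun q := (e q).1
  invFun v := e.symm (v, c)
  source := {q | q ∈ e.source ∧ (e q).2 = c}
  target := {v | (v, c) ∈ e.target}
  map_source' := by
    rintro q ⟨hq, rfl⟩
    exact e.map_source hq
  map_target' := by
    intro v hv
    exact ⟨e.map_target hv, by rw [e.right_inv hv]⟩
  left_inv' := by
    rintro q ⟨hq, rfl⟩
    exact e.left_inv hq
  right_inv' := by
    intro v hv
    rw [e.right_inv hv]

/-- The domain, in a plaque of `e`, of the coordinate change to the chart `e'`. -/
def plaqueOverlap
    (e e' : OpenPartialHomeomorph M (EuclideanSpace ℝ (Fin m) × EuclideanSpace ℝ (Fin n)))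
    (c : EuclideanSpace ℝ (Fin n)) : Set (EuclideanSpace ℝ (Fin m)) :=
  {v | (v, c) ∈ e.target ∧ e.symm (v, c) ∈ e'.source}

theorem isOpen_plaqueOverlap
    (e e' : OpenPartialHomeomorph M (EuclideanSpace ℝ (Fin m) × EuclideanSpace ℝ (Fin n)))
    (c : EuclideanSpace ℝ (Fin n)) : IsOpen (plaqueOverlap e e' c) :=
  (e.symm.isOpen_inter_preimage e'.open_source).preimage (f := fun v => (v, c)) (by fun_prop)

theorem plaqueChart_symm_trans_source
    (e e' : OpenPartialHomeomorph M (EuclideanSpace ℝ (Fin m) × EuclideanSpace ℝ (Fin n)))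
    (c c' : EuclideanSpace ℝ (Fin n)) :
    ((plaqueChart e c).symm.trans (plaqueChart e' c')).source =
      plaqueOverlap e e' c ∩ {v | (e' (e.symm (v, c))).2 = c'} := by
  ext v
  exact ⟨fun h => ⟨⟨h.1, h.2.1⟩, h.2.2⟩, fun h => ⟨h.1.1, h.1.2, h.2⟩⟩

end Plaque

section LeafSpace

variable {m n : ℕ} {M : Type u} [TopologicalSpace M]
  [ChartedSpace (EuclideanSpace ℝ (Fin (m + n))) M] [IsManifold (𝓡 (m + n)) ∞ M]
  {D : TangentDistribution m n M}

/-- Along a map tangent to `D` the second component of a flat chart is locally constant. -/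
theorem IsFlatChart.isOpen_inter_preimage_snd
    {e : OpenPartialHomeomorph M (EuclideanSpace ℝ (Fin m) × EuclideanSpace ℝ (Fin n))}
    (he : IsFlatChart D e) {k : ℕ} {g : EuclideanSpace ℝ (Fin k) → M}
    {O : Set (EuclideanSpace ℝ (Fin k))} (hO : IsOpen O)
    (hg : ContMDiffOn (𝓡 k) (𝓡 (m + n)) ∞ g O) (hmaps : MapsTo g O e.source)
    (htan : ∀ v ∈ O, ∀ ξ, mfderiv (𝓡 k) (𝓡 (m + n)) g v ξ ∈ D.space (g v))
    (s : Set (EuclideanSpace ℝ (Fin n))) : IsOpen (O ∩ (fun v => (e (g v)).2) ⁻¹' s) := by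
  have hder : ∀ v ∈ O, HasFDerivAt (fun v => (e (g v)).2)
      (0 : EuclideanSpace ℝ (Fin k) →L[ℝ] EuclideanSpace ℝ (Fin n)) v := by
    intro v hv
    have h1 : MDifferentiableAt (𝓡 k) (𝓡 (m + n)) g v :=
      (hg.contMDiffAt (hO.mem_nhds hv)).mdifferentiableAt (by simp)
    have h2 := (he.isSmoothCoord.mdifferentiableAt (hmaps hv)).hasMFDerivAt.comp v h1.hasMFDerivAt
    have h3 := (hasMFDerivAt_iff_hasFDerivAt.1 h2).snd
    refine h3.congr_fderiv (ContinuousLinearMap.ext fun ξ => ?_)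
    exact (he.mem_iff _ (hmaps hv) _).1 (htan v hv ξ)
  refine hO.isOpen_inter_preimage_of_fderiv_eq_zero (𝕜 := ℝ)
    (fun v hv => (hder v hv).differentiableAt.differentiableWithinAt)
    (fun v hv => (hder v hv).fderiv) s

theorem IsFlatChart.contMDiffOn_symm_prodMk
    {e : OpenPartialHomeomorph M (EuclideanSpace ℝ (Fin m) × EuclideanSpace ℝ (Fin n))}
    (he : IsFlatChart D e) (c : EuclideanSpace ℝ (Fin n)) :
    ContMDiffOn (𝓡 m) (𝓡 (m + n)) ∞ (fun v => e.symm (v, c)) {v | (v, c) ∈ e.target} := by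
  have h1 : ContDiff ℝ ∞ (fun v : EuclideanSpace ℝ (Fin m) => (v, c)) :=
    contDiff_id.prodMk contDiff_const
  exact he.isSmoothCoord.contMDiffOn_symm.comp h1.contMDiff.contMDiffOn fun v hv => hv

/-- The plaques of a flat chart are tangent to `D`. -/
theorem IsFlatChart.mfderiv_symm_prodMk_mem
    {e : OpenPartialHomeomorph M (EuclideanSpace ℝ (Fin m) × EuclideanSpace ℝ (Fin n))}
    (he : IsFlatChart D e) {c : EuclideanSpace ℝ (Fin n)} {v : EuclideanSpace ℝ (Fin m)}
    (hv : (v, c) ∈ e.target) (ξ : EuclideanSpace ℝ (Fin m)) :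
    mfderiv (𝓡 m) (𝓡 (m + n)) (fun v => e.symm (v, c)) v ξ ∈ D.space (e.symm (v, c)) := by
  have h1 : HasMFDerivAt (𝓡 m) 𝓘(ℝ, EuclideanSpace ℝ (Fin m) × EuclideanSpace ℝ (Fin n))
      (fun v => (v, c)) v ((ContinuousLinearMap.id ℝ _).prod 0) :=
    ((hasFDerivAt_id v).prodMk (hasFDerivAt_const c v)).hasMFDerivAt
  have h2 := ((he.isSmoothCoord.mdifferentiableAt_symm hv).hasMFDerivAt.comp v h1).mfderiv
  have h3 := congrArg (fun L : EuclideanSpace ℝ (Fin m) →L[ℝ]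
    TangentSpace (𝓡 (m + n)) (e.symm (v, c)) => L ξ) h2
  refine (congrArg (fun w => w ∈ D.space (e.symm (v, c))) h3).mpr ?_
  refine (he.mem_iff _ (e.map_target hv) _).2 ?_
  exact congrArg Prod.snd (he.isSmoothCoord.mfderiv_symm_mfderiv hv (ξ, 0))

theorem IsFlatChart.isOpen_plaqueOverlap_inter
    {e e' : OpenPartialHomeomorph M (EuclideanSpace ℝ (Fin m) × EuclideanSpace ℝ (Fin n))}
    (he : IsFlatChart D e) (he' : IsFlatChart D e') (c c' : EuclideanSpace ℝ (Fin n)) :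
    IsOpen (plaqueOverlap e e' c ∩ {v | (e' (e.symm (v, c))).2 = c'}) :=
  he'.isOpen_inter_preimage_snd (g := fun v => e.symm (v, c)) (isOpen_plaqueOverlap e e' c)
    ((he.contMDiffOn_symm_prodMk c).mono fun _ hv => hv.1) (fun _ hv => hv.2)
    (fun _ hv => he.mfderiv_symm_prodMk_mem hv.1) {c'}

theorem IsFlatChart.contDiffOn_plaqueChart_symm_trans
    {e e' : OpenPartialHomeomorph M (EuclideanSpace ℝ (Fin m) × EuclideanSpace ℝ (Fin n))}
    (he : IsFlatChart D e) (he' : IsFlatChart D e') (c c' : EuclideanSpace ℝ (Fin n)) :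
    ContDiffOn ℝ ∞ ((plaqueChart e c).symm.trans (plaqueChart e' c'))
      ((plaqueChart e c).symm.trans (plaqueChart e' c')).source := by
  rw [plaqueChart_symm_trans_source]
  have h1 : ContDiffOn ℝ ∞ (fun v => e' (e.symm (v, c))) (plaqueOverlap e e' c) := by
    rw [← contMDiffOn_iff_contDiffOn]
    exact he'.isSmoothCoord.contMDiffOn.comp
      ((he.contMDiffOn_symm_prodMk c).mono fun _ hv => hv.1) fun _ hv => hv.2
  exact h1.fst.mono inter_subset_left

namespace HasFlatCharts

variable (h : HasFlatCharts D)

/-- A flat chart at `p`. -/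
def flatChart (p : M) :
    OpenPartialHomeomorph M (EuclideanSpace ℝ (Fin m) × EuclideanSpace ℝ (Fin n)) :=
  (h p).choose

theorem isFlatChart (p : M) : IsFlatChart D (h.flatChart p) := (h p).choose_spec.1

theorem mem_flatChart_source (p : M) : p ∈ (h.flatChart p).source := (h p).choose_spec.2

/-- The plaques of all flat charts as the charts of a manifold structure on the set `M`. -/
def leafCore : ChartedSpaceCore (EuclideanSpace ℝ (Fin m)) M where
  atlas := {φ | ∃ e c, IsFlatChart D e ∧ φ = plaqueChart e c}
  chartAt p := plaqueChart (h.flatChart p) (h.flatChart p p).2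
  mem_chart_source p := ⟨h.mem_flatChart_source p, rfl⟩
  chart_mem_atlas p := ⟨_, _, h.isFlatChart p, rfl⟩
  open_source := by
    rintro _ _ ⟨e, c, he, rfl⟩ ⟨e', c', he', rfl⟩
    rw [plaqueChart_symm_trans_source]
    exact he.isOpen_plaqueOverlap_inter he' c c'
  continuousOn_toFun := by
    rintro _ _ ⟨e, c, he, rfl⟩ ⟨e', c', he', rfl⟩
    exact (he.contDiffOn_plaqueChart_symm_trans he' c c').continuousOn

/-- The set `M` with the topology generated by the open subsets of plaques. It is an
`m`-dimensional manifold, whose connected components are the leaves of `D`, and which in general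
is not second countable. -/
def LeafSpace (_ : HasFlatCharts D) : Type u := M

instance : TopologicalSpace h.LeafSpace := h.leafCore.toTopologicalSpace

instance : ChartedSpace (EuclideanSpace ℝ (Fin m)) h.LeafSpace := h.leafCore.toChartedSpace

instance : IsManifold (𝓡 m) ∞ h.LeafSpace := by
  refine isManifold_of_contDiffOn _ _ _ fun φ φ' hφ hφ' => ?_
  obtain ⟨_, ⟨_, rfl⟩, _, ⟨⟨e, c, he, rfl⟩, rfl⟩, rfl⟩ := hφ
  obtain ⟨_, ⟨_, rfl⟩, _, ⟨⟨e', c', he', rfl⟩, rfl⟩, rfl⟩ := hφ'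
  refine (he.contDiffOn_plaqueChart_symm_trans he' c c').mono ?_
  intro v hv
  exact hv.1

/-- The bijection of the leaf space with `M`. -/
def leafVal : h.LeafSpace → M := id

theorem leafVal_injective : Function.Injective h.leafVal := fun _ _ => id

theorem isImmersion_leafVal : Manifold.IsImmersion (𝓡 m) (𝓡 (m + n)) ∞ h.leafVal := by
  refine isImmersion_of_isSmoothCoord rfl fun p => ?_
  refine ⟨chartAt _ p, h.flatChart (h.leafVal p), (h.flatChart (h.leafVal p) (h.leafVal p)).2,
    IsSmoothCoord.of_chartAt p, (h.isFlatChart _).isSmoothCoord, mem_chart_source _ p,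
    fun q hq => ?_⟩
  exact ⟨hq.1, Prod.ext rfl hq.2⟩

theorem range_mfderiv_leafVal_le (p : h.LeafSpace) :
    (mfderiv (𝓡 m) (𝓡 (m + n)) h.leafVal p).range ≤ D.space (h.leafVal p) := by
  rintro _ ⟨ξ, rfl⟩
  have he := h.isFlatChart (h.leafVal p)
  have hp := h.mem_flatChart_source (h.leafVal p)
  refine (he.mem_iff _ hp _).2 ?_
  have h1 : MDifferentiableAt (𝓡 m) (𝓡 (m + n)) h.leafVal p :=
    (h.isImmersion_leafVal.contMDiff p).mdifferentiableAt (by simp)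
  have h2 := (he.isSmoothCoord.mdifferentiableAt hp).hasMFDerivAt.comp p h1.hasMFDerivAt
  have h3 := ((ContinuousLinearMap.snd ℝ (EuclideanSpace ℝ (Fin m))
    (EuclideanSpace ℝ (Fin n))).hasMFDerivAt).comp p h2
  have h4 : (fun q => (h.flatChart (h.leafVal p) (h.leafVal q)).2) =ᶠ[𝓝 p]
      fun _ => (h.flatChart (h.leafVal p) (h.leafVal p)).2 := by
    filter_upwards [chart_source_mem_nhds (EuclideanSpace ℝ (Fin m)) p] with q hq using hq.2
  have h5 := hasMFDerivAt_unique h3 ((hasMFDerivAt_const _ p).congr_of_eventuallyEq h4)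
  exact congrArg (fun L : TangentSpace (𝓡 m) p →L[ℝ] EuclideanSpace ℝ (Fin n) => L ξ) h5

/-- Every integral manifold is contained in an integral manifold of the dimension of `D`: it is
covered by countably many plaques, whose union is an open subset of the leaf space. -/
theorem exists_integralManifold (h : HasFlatCharts D) {k : ℕ} (N : D.IntegralManifold k) :
    ∃ N' : D.IntegralManifold m, N.toSet ⊆ N'.toSet := by
  -- A neighbourhood of `q` in `N` lies in the plaque through `N.f q`.
  have hnhds : ∀ q : N.carrier, {q' | N.f q' ∈ (h.flatChart (N.f q)).source ∧
      (h.flatChart (N.f q) (N.f q')).2 = (h.flatChart (N.f q) (N.f q)).2} ∈ 𝓝 q := by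
    intro q
    set e := h.flatChart (N.f q)
    have he : IsFlatChart D e := h.isFlatChart _
    have hqe : N.f q ∈ e.source := h.mem_flatChart_source _
    set φ := chartAt (EuclideanSpace ℝ (Fin k)) q
    have hqφ : q ∈ φ.source := mem_chart_source _ q
    have hφ : IsSmoothCoord k φ := IsSmoothCoord.of_chartAt q
    have hf := N.immersion.contMDiff
    have hO : IsOpen (φ.target ∩ φ.symm ⁻¹' (N.f ⁻¹' e.source)) :=
      φ.isOpen_inter_preimage_symm (e.open_source.preimage hf.continuous)
    have hopen := he.isOpen_inter_preimage_snd (g := N.f ∘ φ.symm) hO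
      (hf.comp_contMDiffOn (hφ.contMDiffOn_symm.mono inter_subset_left)) (fun v hv => hv.2) (by
        intro v hv ξ
        have h1 := mfderiv_comp v (((hf (φ.symm v)).mdifferentiableAt (by simp)))
          (hφ.mdifferentiableAt_symm hv.1)
        have h2 := congrArg (fun L : EuclideanSpace ℝ (Fin k) →L[ℝ]
          TangentSpace (𝓡 (m + n)) (N.f (φ.symm v)) => L ξ) h1
        exact (congrArg (fun w => w ∈ D.space (N.f (φ.symm v))) h2).mpr (N.tangent _ ⟨_, rfl⟩))
      {(e (N.f q)).2}
    have hmem := φ.continuousAt hqφ (hopen.mem_nhds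
      ⟨⟨φ.map_source hqφ, by simpa [φ.left_inv hqφ] using hqe⟩, by simp [φ.left_inv hqφ]⟩)
    filter_upwards [hmem, φ.open_source.mem_nhds hqφ] with q' hq' hq'φ
    obtain ⟨⟨-, h1⟩, h2⟩ := hq'
    simp only [mem_preimage, Function.comp_apply, φ.left_inv hq'φ] at h1 h2
    exact ⟨h1, h2⟩
  obtain ⟨t, htc, ht⟩ := TopologicalSpace.countable_cover_nhds hnhds
  have hcov : ∀ q, ∃ p ∈ t, (show h.LeafSpace from N.f q) ∈
      (chartAt (EuclideanSpace ℝ (Fin m)) (show h.LeafSpace from N.f p)).source := by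
    intro q
    obtain ⟨p, hp, hq⟩ := mem_iUnion₂.1 (ht ▸ mem_univ q)
    exact ⟨p, hp, hq⟩
  let s : TopologicalSpace.Opens h.LeafSpace :=
    ⟨⋃ p ∈ t, (chartAt (EuclideanSpace ℝ (Fin m)) (show h.LeafSpace from N.f p)).source,
      isOpen_biUnion fun p _ => (chartAt _ _).open_source⟩
  have hs : ∀ q, (show h.LeafSpace from N.f q) ∈ s := fun q => by
    obtain ⟨p, hp, hq⟩ := hcov q
    exact mem_iUnion₂.2 ⟨p, hp, hq⟩
  have : Nonempty s := by
    obtain ⟨q⟩ := N.nonempty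
    exact ⟨⟨_, hs q⟩⟩
  have : SecondCountableTopology s := by
    refine ChartedSpace.secondCountable_of_countable_cover (EuclideanSpace ℝ (Fin m))
      (s := (fun p => (⟨N.f p, hs p⟩ : s)) '' t) ?_ (htc.image _)
    refine eq_univ_of_forall fun x => ?_
    obtain ⟨p, hp, hx⟩ := mem_iUnion₂.1 x.2
    refine mem_iUnion₂.2 ⟨_, mem_image_of_mem _ hp, ?_⟩
    rw [TopologicalSpace.Opens.chartAt_eq, OpenPartialHomeomorph.subtypeRestr_source]
    exact hx
  refine ⟨.ofOpens D h.leafVal_injective h.isImmersion_leafVal h.range_mfderiv_leafVal_le s, ?_⟩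
  rintro _ ⟨q, rfl⟩
  exact ⟨⟨_, hs q⟩, rfl⟩

/-- A distribution with flat charts is completely integrable. -/
theorem isCompletelyIntegrable (h : HasFlatCharts D) : D.IsCompletelyIntegrable := by
  intro k N hN
  refine le_antisymm N.dim_le (not_lt.1 fun hk => ?_)
  obtain ⟨q⟩ := N.nonempty
  obtain ⟨U, -, -, hU⟩ := hN (N.f q) (mem_range_self q)
  obtain ⟨N', hN'⟩ := h.exists_integralManifold N
  exact hU ⟨m, N', hk, inter_subset_left.trans hN'⟩

end HasFlatCharts

end LeafSpace

end

theorem mainTheorem2 {m n : ℕ} {M : Type u} [TopologicalSpace M] [T2Space M]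
    [SecondCountableTopology M] [ChartedSpace (EuclideanSpace ℝ (Fin (m + n))) M]
    [IsManifold (𝓡 (m + n)) ∞ M] (D : TangentDistribution m n M) :
    D.IsCompletelyIntegrable ↔ D.vectorFields ⊆ D.symmetries := by
  constructor
  · intro hD
    exact (hasFlatCharts_of_isCompletelyIntegrable hD).vectorFields_subset_symmetries
  · intro hD
    have h : HasFlatCharts D := fun p => by
      obtain ⟨e, A, he, hp⟩ := exists_isGraphChart D p
      exact he.exists_isFlatChart
        (fun x hx => he.isInvolutiveAt_of_vectorFields_subset hD hx) hp
    exact h.isCompletelyIntegrable
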